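/- Let $k$ be a field and let $A$ be a $k$-algebra (associative, with unit). Let $(L(\lambda))_{\lambda\in\Lambda}$ be a complete irredundant list of the simple left $A$-modules (every simple module is isomorphic to exactly one of them), and let $P(\lambda)$ be a projective cover of $L(\lambda)$. For a module $M$ put $\operatorname{rad}^0M=M$ and $\operatorname{rad}^{s+1}M=\operatorname{rad}(\operatorname{rad}^sM)$, where $\operatorname{rad}$ denotes the intersection of all maximal submodules. Assume that one of the following holds. (a) $A$ is cellular: there are a finite poset $\pi$, finite sets $M(\lambda)$ $(\lambda\in\pi)$, a $k$-basis $C^\lambda_{S,T}$ $(\lambda\in\pi,\ S,T\in M(\lambda))$ of $A$ and a $k$-linear anti-automorphism $i$ of $A$ with $i^2=\mathrm{id}$ and $i(C^\lambda_{S,T})=C^\lambda_{T,S}$, such that for all $a\in A$, $\lambda\in\pi$ and $S,T\in M(\lambda)$ the element $aC^\lambda_{S,T}-\sum_{U\in M(\lambda)}r_a(U,S)\,C^\lambda_{U,T}$ is a linear combination of basis elements with upper index strictly less than $\lambda$, where the coefficients $r_a(U,S)\in k$ do not depend on $T$. (b) $A$ is a BGG algebra with simple modules $L(\lambda)$: $k$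 is algebraically closed, $A$ is finite dimensional, and for some partial order on $\Lambda$, writing $\Delta(\lambda)$ for the largest quotient of $P(\lambda)$ all of whose composition factors are of the form $L(\mu)$ with $\mu\le\lambda$, one has $\operatorname{End}_A(\Delta(\lambda))=k$ for all $\lambda$, and every finitely generated projective $A$-module has a finite filtration with successive quotients of the form $\Delta(\lambda)$; moreover there is a contravariant, exact, additive, $k$-linear functor $\delta$ from the category of finitely generated left $A$-modules to itself with $\delta\circ\delta\cong\mathrm{id}$ and $\delta(L(\lambda))\cong L(\lambda)$ for all $\lambda$. Let $s\ge1$, $\bar A=A/\operatorname{rad}^sA$ and $\bar P(\lambda)=P(\lambda)/\operatorname{rad}^sP(\lambda)$. Then $\bar A$ is a finite-dimensional $k$-algebra; the $A$-module structures of the $L(\lambda)$ and of the $\bar P(\lambda)$ factor through $\bar A$; the $L(\lambda)$, $\lambda\in\Lambda$, form a complete irredundant list of the simple $\bar A$-modules; each $\bar P(\lambda)$ is a principal indecomposable $\bar A$-module (an indecomposable direct summand of $\bar A$, up to isomorphism) and a projective cover of $L(\lambda)$ over $\bar A$; and every principal indecomposable $\bar A$-module is isomorphic to $\bar P(\lambda)$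 for exactly one $\lambda$. The Cartan matrix of $\bar A$, whose entries are the composition multiplicities $\bar C_{\lambda\mu}=[\bar P(\lambda):L(\mu)]$, is symmetric: $\bar C_{\lambda\mu}=\bar C_{\mu\lambda}$ for all $\lambda,\mu\in\Lambda$. -/

import Mathlib

open CategoryTheory

universe u

/-! ### Radical series -/

/-- The radical series of a module: `rad^0 M = M` and `rad^(s+1) M = rad (rad^s M)`, where the
radical of a module is the intersection of its maximal submodules (for modules of finite length,
the smallest submodule with semisimple quotient). -/
def radSeries (A M : Type*) [Ring A] [AddCommGroup M] [Module A M] : ℕ → Submodule A M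
  | 0 => ⊤
  | s + 1 => (Module.jacobson A (radSeries A M s)).map (radSeries A M s).subtype

/-- Module homomorphisms respect the radical series. -/
theorem radSeries_le_comap {A M N : Type*} [Ring A] [AddCommGroup M] [Module A M]
    [AddCommGroup N] [Module A N] (f : M →ₗ[A] N) (s : ℕ) :
    radSeries A M s ≤ (radSeries A N s).comap f := by
  induction s with
  | zero => intro x _; exact Submodule.mem_top
  | succ s ih =>
    rintro x ⟨y, hy, rfl⟩
    have h := Module.le_comap_jacobson (f := f.restrict ih) hy
    exact ⟨_, h, rfl⟩

/-- `rad^s A` is a two-sided ideal, so that `A ⧸ radSeries A A s` is again an algebra. -/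
instance radSeries_isTwoSided (A : Type*) [Ring A] (s : ℕ) :
    Ideal.IsTwoSided (radSeries A A s : Ideal A) :=
  ⟨fun b ha => radSeries_le_comap (LinearMap.toSpanSingleton A A b) s ha⟩

/-- The algebra `A / rad^s A`. -/
abbrev RadQuotient (A : Type*) [Ring A] (s : ℕ) : Type _ := A ⧸ (radSeries A A s : Ideal A)

/-! ### Simple modules, projective covers, principal indecomposable modules -/

/-- `L` is a complete and irredundant list of the simple left `A`-modules. (Every simple
`A`-module is a quotient of `A`, so it is enough to look at modules in the universe of `A`.) -/
structure IsCompleteListOfSimples (A : Type u) [Ring A] {Λ : Type*} (L : Λ → Type u)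
    [∀ l, AddCommGroup (L l)] [∀ l, Module A (L l)] : Prop where
  simple : ∀ l, IsSimpleModule A (L l)
  irredundant : ∀ l m, Nonempty (L l ≃ₗ[A] L m) → l = m
  complete : ∀ (S : Type u) [AddCommGroup S] [Module A S], IsSimpleModule A S →
    ∃ l, Nonempty (S ≃ₗ[A] L l)

/-- `P` is a projective cover of `L`: it is projective and there is an epimorphism `P → L` whose
kernel is superfluous. -/
def IsProjectiveCover (A P L : Type*) [Ring A] [AddCommGroup P] [Module A P]
    [AddCommGroup L] [Module A L] : Prop :=
  Module.Projective A P ∧ ∃ f : P →ₗ[A] L, Function.Surjective f ∧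
    ∀ N : Submodule A P, N ⊔ LinearMap.ker f = ⊤ → N = ⊤

/-- A principal indecomposable module of `A`: an indecomposable module which is isomorphic to a
direct summand of the regular module. -/
structure IsPrincipalIndecomposable (A P : Type*) [Ring A] [AddCommGroup P] [Module A P] :
    Prop where
  nontrivial : Nontrivial P
  indecomposable : ∀ N K : Submodule A P, IsCompl N K → N = ⊥ ∨ K = ⊥
  summand : ∃ (i : P →ₗ[A] A) (r : A →ₗ[A] P), r ∘ₗ i = LinearMap.id

/-! ### Composition multiplicities and the Cartan matrix -/

open Classical in
/-- The number of factors isomorphic to `S` in a composition series (in the sense of chains of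
submodules with simple successive quotients). -/
noncomputable def seriesMultiplicity {A M : Type*} [Ring A] [AddCommGroup M] [Module A M]
    (c : CompositionSeries (Submodule A M)) (S : Type*) [AddCommGroup S] [Module A S] : ℕ :=
  (Finset.univ.filter fun i : Fin c.length =>
    Nonempty ((↥(c i.succ) ⧸ (c i.castSucc).submoduleOf (c i.succ)) ≃ₗ[A] S)).card

open Classical in
/-- The composition multiplicity `[M : S]`, computed from a composition series of `M` from `0` to
`M`. (It does not depend on the choice of the series; the value is `0` if `M` has none.) -/
noncomputable def compMultiplicity (A M S : Type*) [Ring A] [AddCommGroup M] [Module A M]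
    [AddCommGroup S] [Module A S] : ℕ :=
  if h : ∃ c : CompositionSeries (Submodule A M), c.head = ⊥ ∧ c.last = ⊤ then
    seriesMultiplicity h.choose S
  else 0

/-- The Cartan matrix, with entries `[P(l) : L(m)]`. -/
noncomputable def algCartanMatrix (A : Type*) [Ring A] {Λ : Type*} (P L : Λ → Type*)
    [∀ l, AddCommGroup (P l)] [∀ l, Module A (P l)]
    [∀ l, AddCommGroup (L l)] [∀ l, Module A (L l)] : Matrix Λ Λ ℕ :=
  Matrix.of fun l m => compMultiplicity A (P l) (L m)

/-! ### Cellular algebras -/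

/-- A cell datum for the `k`-algebra `A`. -/
structure CellDatum (k A : Type*) [Field k] [Ring A] [Algebra k A] where
  /-- The finite poset. -/
  Cell : Type
  [order : PartialOrder Cell]
  [finCell : Finite Cell]
  /-- The finite index sets `M(l)`. -/
  Idx : Cell → Type
  [finIdx : ∀ l, Fintype (Idx l)]
  /-- The cellular basis: `C ⟨l, S, T⟩` is the element with upper index `l` and lower indices
  `S, T`. -/
  C : Module.Basis (Σ l : Cell, Idx l × Idx l) k A
  /-- The anti-involution. -/
  inv : A →ₗ[k] A
  inv_mul : ∀ a b, inv (a * b) = inv b * inv a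
  inv_inv : ∀ a, inv (inv a) = a
  inv_basis : ∀ (l : Cell) (S T : Idx l), inv (C ⟨l, S, T⟩) = C ⟨l, T, S⟩
  mul_basis : ∀ (l : Cell) (a : A), ∃ r : Idx l → Idx l → k, ∀ S T : Idx l,
    a * C ⟨l, S, T⟩ - ∑ U, r U S • C ⟨l, U, T⟩ ∈
      Submodule.span k {x : A | ∃ (m : Cell) (U V : Idx m), m < l ∧ x = C ⟨m, U, V⟩}

/-- `A` is a cellular algebra over `k`. -/
def IsCellularAlgebra (k A : Type*) [Field k] [Ring A] [Algebra k A] : Prop :=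
  Nonempty (CellDatum k A)

/-! ### Quasi-hereditary algebras and BGG algebras -/

section QuasiHereditary

variable (A : Type u) [Ring A] {Λ : Type*} [PartialOrder Λ] (L P : Λ → Type u)
  [∀ l, AddCommGroup (L l)] [∀ l, Module A (L l)]
  [∀ l, AddCommGroup (P l)] [∀ l, Module A (P l)]

/-- All composition factors of `M` (its simple subquotients `N₂ / N₁`) are of the form `L(m)` with
`m ≤ l`. -/
def CompFactorsLE (l : Λ) (M : Type*) [AddCommGroup M] [Module A M] : Prop :=
  ∀ N₁ N₂ : Submodule A M, N₁ ⋖ N₂ →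
    ∃ m ≤ l, Nonempty ((↥N₂ ⧸ N₁.submoduleOf N₂) ≃ₗ[A] L m)

/-- The smallest submodule of `P(l)` such that all composition factors of the quotient are of the
form `L(m)` with `m ≤ l`. -/
def standardKernel (l : Λ) : Submodule A (P l) :=
  sInf {N : Submodule A (P l) | CompFactorsLE A L l (P l ⧸ N)}

/-- The standard module `Δ(l)`: the largest quotient of `P(l)` all of whose composition factors are
of the form `L(m)` with `m ≤ l`. -/
abbrev StandardModule (l : Λ) : Type u := P l ⧸ standardKernel A L P l

/-- `M` has a finite filtration whose successive quotients are standard modules. -/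
def HasStandardFiltration (M : Type*) [AddCommGroup M] [Module A M] : Prop :=
  ∃ (n : ℕ) (F : Fin (n + 1) → Submodule A M), Monotone F ∧ F 0 = ⊥ ∧ F (Fin.last n) = ⊤ ∧
    ∀ i : Fin n, ∃ l : Λ, Nonempty
      ((↥(F i.succ) ⧸ (F i.castSucc).submoduleOf (F i.succ)) ≃ₗ[A] StandardModule A L P l)

/-- `A` is a quasi-hereditary algebra over the algebraically closed field `k`, with simple modules
`L(l)` indexed by the poset `Λ` and with projective covers `P(l)`. The field `end_standard` says
that `k → End_A(Δ(l))` is bijective. -/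
structure IsQuasiHereditary (k : Type*) [Field k] [Algebra k A] : Prop where
  algClosed : IsAlgClosed k
  finite : Module.Finite k A
  simples : IsCompleteListOfSimples A L
  cover : ∀ l, IsProjectiveCover A (P l) (L l)
  end_standard : ∀ (l : Λ) (f : StandardModule A L P l →ₗ[A] StandardModule A L P l),
    ∃! c : k, ∀ x, f x = algebraMap k A c • x
  filtration : ∀ (Q : Type u) [AddCommGroup Q] [Module A Q], Module.Finite A Q →
    Module.Projective A Q → HasStandardFiltration A L P Q

end QuasiHereditary

/-- A duality on the category of finitely generated left `A`-modules: a contravariant, additive,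
`k`-linear, exact functor `δ` such that `δ ∘ δ` is naturally isomorphic to the identity. -/
structure IsDuality (k : Type*) (A : Type u) [Field k] [Ring A] [Algebra k A]
    (δ : (FGModuleCat.{u} A)ᵒᵖ ⥤ FGModuleCat.{u} A) : Prop where
  additive : δ.Additive
  smul : ∀ (X Y : FGModuleCat.{u} A) (f g : X ⟶ Y) (c : k),
    (∀ x, g.hom.hom x = algebraMap k A c • f.hom.hom x) →
      ∀ y, (δ.map g.op).hom.hom y = algebraMap k A c • (δ.map f.op).hom.hom y
  exact : ∀ (X Y Z : FGModuleCat.{u} A) (f : X ⟶ Y) (g : Y ⟶ Z),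
    Function.Injective f.hom.hom → Function.Exact f.hom.hom g.hom.hom →
      Function.Surjective g.hom.hom →
    Function.Injective (δ.map g.op).hom.hom ∧
      Function.Exact (δ.map g.op).hom.hom (δ.map f.op).hom.hom ∧
      Function.Surjective (δ.map f.op).hom.hom
  involutive : Nonempty (δ.rightOp ⋙ δ ≅ 𝟭 (FGModuleCat.{u} A))

/-- `A` is a BGG algebra over `k`, with simple modules `L(l)` and projective covers `P(l)`: for some
partial order on the index set it is quasi-hereditary, and there is a duality that fixes the simple
modules up to isomorphism. -/
def IsBGGAlgebra (k : Type*) (A : Type u) [Field k] [Ring A] [Algebra k A] {Λ : Type*}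
    (L P : Λ → Type u) [∀ l, AddCommGroup (L l)] [∀ l, Module A (L l)]
    [∀ l, AddCommGroup (P l)] [∀ l, Module A (P l)] : Prop :=
  (∃ _ : PartialOrder Λ, IsQuasiHereditary A L P k) ∧
    ∃ δ : (FGModuleCat.{u} A)ᵒᵖ ⥤ FGModuleCat.{u} A, IsDuality k A δ ∧
      ∀ (l : Λ) (X : FGModuleCat.{u} A), Nonempty (X ≃ₗ[A] L l) →
        Nonempty (δ.obj (Opposite.op X) ≃ₗ[A] L l)

/-! Write `B = A / rad^s A`. The Cartan matrix of `B` is symmetric because there is an exact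
contravariant duality `D` on finitely generated `B`-modules that fixes the simple modules, and
simple modules have only scalar endomorphisms. Put `h(M, N) = dim Hom(M, D N)`. The duality gives
`Hom(M, D N) ≅ Hom(N, D M)`, so `h` is symmetric. For a projective `P` the function `h(P, -)` is
additive on short exact sequences, and `h(P(l), L(m)) = dim Hom(P(l), L(m))` is `1` for `l = m` and
`0` otherwise. Hence `[M : L(m)] = h(P(m), M)`, and `[P(l) : L(m)] = h(P(m), P(l))` is symmetric in
`l` and `m` (`algCartanMatrix_isSymm_of_form`).

It remains to find `D`. For a cellular algebra, `D` is the linear dual twisted by the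
anti-involution. A simple module carries a nonzero invariant form, coming from the form of a minimal
cell that acts on it, and such a form is an isomorphism with the twisted dual; the same computation
shows that endomorphisms are scalars over any field (`CellDatum.hasInvariantForm_and_end`). The
invariant forms also show that the anti-involution preserves the Jacobson radical, hence `rad^s A`,
so that it descends to `B`.

For a BGG algebra, `D` is the given `δ`, and Schur's lemma gives scalar endomorphisms. What has to
be shown is that `δ` preserves the modules killed by `rad^s A`
(`IsDuality.isTorsionBySet_radSeries`); it preserves semisimplicity, and induction on the radical
layers does the rest.

The remaining statements on `B` hold because `P(l)` is a summand of `A` and the quotient by `rad^s`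
is functorial. -/

/-! ### Simple modules and projective covers -/

section General

variable {R : Type*} [Ring R]

/-- A nonzero map from a projective cover of a simple module to a simple module factors through
that simple module by an isomorphism. -/
theorem exists_equiv_of_superfluous {P L S : Type*} [AddCommGroup P] [Module R P]
    [AddCommGroup L] [Module R L] [AddCommGroup S] [Module R S] [IsSimpleModule R L]
    [IsSimpleModule R S] {f : P →ₗ[R] L} (hf : Function.Surjective f)
    (hs : ∀ N : Submodule R P, N ⊔ LinearMap.ker f = ⊤ → N = ⊤) {g : P →ₗ[R] S} (hg : g ≠ 0) :
    ∃ e : L ≃ₗ[R] S, e.toLinearMap ∘ₗ f = g := by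
  have hgs : Function.Surjective g := LinearMap.surjective_of_ne_zero hg
  have cf := LinearMap.isCoatom_ker_of_surjective hf
  have cg := LinearMap.isCoatom_ker_of_surjective hgs
  have hle : LinearMap.ker f ≤ LinearMap.ker g := by
    by_contra h
    exact cg.1 (hs _ (cg.2 _ (left_lt_sup.2 h)))
  let h : L →ₗ[R] S :=
    (LinearMap.ker f).liftQ g hle ∘ₗ (f.quotKerEquivOfSurjective hf).symm.toLinearMap
  have hh : h ∘ₗ f = g := by
    ext x
    have : (f.quotKerEquivOfSurjective hf).symm (f x) = Submodule.Quotient.mk x := by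
      rw [LinearEquiv.symm_apply_eq]; rfl
    simp [h, this]
  have h0 : h ≠ 0 := by
    rintro h0
    rw [h0, LinearMap.zero_comp] at hh
    exact hg hh.symm
  exact ⟨LinearEquiv.ofBijective h (LinearMap.bijective_of_ne_zero h0), hh⟩

/-- Any `x` outside the kernel of `P → L` generates `P`: the kernel is maximal, so `R x + ker f =
P`, and it is superfluous. Thus `P` is a quotient of `R`, and projectivity splits the quotient map.
-/
theorem IsProjectiveCover.exists_split {P L : Type*} [AddCommGroup P] [Module R P]
    [AddCommGroup L] [Module R L] [IsSimpleModule R L] (h : IsProjectiveCover R P L) :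
    ∃ (i : P →ₗ[R] R) (r : R →ₗ[R] P), r ∘ₗ i = LinearMap.id := by
  obtain ⟨hP, f, hf, hs⟩ := h
  have := IsSimpleModule.nontrivial R L
  obtain ⟨y, hy⟩ := exists_ne (0 : L)
  obtain ⟨x, rfl⟩ := hf y
  have hsurj : Function.Surjective (LinearMap.toSpanSingleton R P x) := by
    rw [← LinearMap.range_eq_top]
    apply hs
    by_contra hne
    have := ((LinearMap.isCoatom_ker_of_surjective hf).le_iff.1 le_sup_right).resolve_left hne
    have hx : x ∈ LinearMap.range (LinearMap.toSpanSingleton R P x) ⊔ LinearMap.ker f :=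
      Submodule.mem_sup_left ⟨1, by simp⟩
    rw [this] at hx
    exact hy hx
  obtain ⟨i, hi⟩ := Module.projective_lifting_property _ LinearMap.id hsurj
  exact ⟨i, _, hi⟩

theorem IsProjectiveCover.finite {P L : Type*} [AddCommGroup P] [Module R P]
    [AddCommGroup L] [Module R L] [IsSimpleModule R L] (h : IsProjectiveCover R P L) :
    Module.Finite R P := by
  obtain ⟨i, r, hr⟩ := h.exists_split
  exact Module.Finite.of_surjective r fun x => ⟨i x, LinearMap.congr_fun hr x⟩

/-- The kernel of `P → L` contains every proper submodule, so two proper submodules never span `P`.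
-/
theorem IsProjectiveCover.isPrincipalIndecomposable {P L : Type*} [AddCommGroup P] [Module R P]
    [AddCommGroup L] [Module R L] [IsSimpleModule R L] (h : IsProjectiveCover R P L) :
    IsPrincipalIndecomposable R P := by
  have hsplit := h.exists_split
  obtain ⟨hP, f, hf, hs⟩ := h
  have := IsSimpleModule.nontrivial R L
  refine ⟨hf.nontrivial, fun N K hNK => ?_, hsplit⟩
  have c := LinearMap.isCoatom_ker_of_surjective hf
  have key : ∀ N : Submodule R P, ¬ N ≤ LinearMap.ker f → N = ⊤ := fun N hN =>
    hs N (by rw [sup_comm]; exact c.2 _ (left_lt_sup.2 hN))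
  by_cases hN : N ≤ LinearMap.ker f
  · by_cases hK : K ≤ LinearMap.ker f
    · exact absurd (top_le_iff.1 (hNK.sup_eq_top.ge.trans (sup_le hN hK))) c.1
    · left
      have := hNK.inf_eq_bot
      rwa [key K hK, inf_top_eq] at this
  · right
    have := hNK.inf_eq_bot
    rwa [key N hN, top_inf_eq] at this

theorem IsPrincipalIndecomposable.projective {Q : Type*} [AddCommGroup Q] [Module R Q]
    (h : IsPrincipalIndecomposable R Q) : Module.Projective R Q :=
  let ⟨i, r, hr⟩ := h.summand
  .of_split i r hr

theorem IsPrincipalIndecomposable.finite {Q : Type*} [AddCommGroup Q] [Module R Q]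
    (h : IsPrincipalIndecomposable R Q) : Module.Finite R Q :=
  let ⟨i, r, hr⟩ := h.summand
  Module.Finite.of_surjective r fun x => ⟨i x, LinearMap.congr_fun hr x⟩

/-- An indecomposable projective module which maps onto a simple module with projective cover `P`
is isomorphic to `P`. -/
theorem IsPrincipalIndecomposable.equiv_of_surjective {P Q L : Type*} [AddCommGroup P] [Module R P]
    [AddCommGroup Q] [Module R Q] [AddCommGroup L] [Module R L] [IsSimpleModule R L]
    (hQ : IsPrincipalIndecomposable R Q) (hP : IsProjectiveCover R P L)
    {g : Q →ₗ[R] L} (hg : Function.Surjective g) : Nonempty (Q ≃ₗ[R] P) := by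
  have hPn := hP.isPrincipalIndecomposable.nontrivial
  have := hQ.projective
  obtain ⟨_, f, hf, hs⟩ := hP
  obtain ⟨a, ha⟩ := Module.projective_lifting_property f g hf
  have hsurj : Function.Surjective a := by
    rw [← LinearMap.range_eq_top]
    -- Since `g` is onto, the image of `a` together with `ker f` is all of `P`.
    refine hs _ (top_le_iff.1 fun x _ => ?_)
    obtain ⟨y, hy⟩ := hg (f x)
    have h2 : f (a y) = f x := by rw [← hy, ← ha]; rfl
    have : x = a y + (x - a y) := by abel
    rw [this]
    exact Submodule.add_mem_sup ⟨y, rfl⟩ (by simp [h2])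
  obtain ⟨b, hb⟩ := Module.projective_lifting_property a LinearMap.id hsurj
  have hc : IsCompl (LinearMap.ker a) (LinearMap.range b) := by
    constructor
    · rw [Submodule.disjoint_def]
      rintro _ hx ⟨y, rfl⟩
      have h1 : a (b y) = y := LinearMap.congr_fun hb y
      rw [LinearMap.mem_ker, h1] at hx
      rw [hx, map_zero]
    · rw [codisjoint_iff, eq_top_iff]
      intro x _
      have h1 : a (b (a x)) = a x := LinearMap.congr_fun hb (a x)
      have : x = (x - b (a x)) + b (a x) := by abel
      rw [this]
      exact Submodule.add_mem_sup (by simp [h1]) ⟨_, rfl⟩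
  rcases hQ.indecomposable _ _ hc with h | h
  · exact ⟨LinearEquiv.ofBijective a ⟨LinearMap.ker_eq_bot.1 h, hsurj⟩⟩
  · obtain ⟨x, hx⟩ := exists_ne (0 : P)
    have h1 : a (b x) = x := LinearMap.congr_fun hb x
    have h2 : b x = 0 := LinearMap.congr_fun (LinearMap.range_eq_bot.1 h) x
    rw [h2, map_zero] at h1
    exact absurd h1.symm hx

end General

/-- Existence: `Q` is finitely generated, so it has a simple quotient `L(l)`. Uniqueness: a
projective cover of a simple module has no other simple quotient up to isomorphism. -/
theorem existsUnique_equiv_projectiveCover {R : Type u} [Ring R] {Λ : Type*} {L P : Λ → Type u}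
    [∀ l, AddCommGroup (L l)] [∀ l, Module R (L l)]
    [∀ l, AddCommGroup (P l)] [∀ l, Module R (P l)]
    (hL : IsCompleteListOfSimples R L) (hP : ∀ l, IsProjectiveCover R (P l) (L l))
    {Q : Type u} [AddCommGroup Q] [Module R Q] (hQ : IsPrincipalIndecomposable R Q) :
    ∃! l, Nonempty (Q ≃ₗ[R] P l) := by
  have := hL.simple
  have := hQ.finite
  have := hQ.nontrivial
  obtain ⟨m, hm, -⟩ := (eq_top_or_exists_le_coatom (⊥ : Submodule R Q)).resolve_left bot_ne_top
  have hsm : IsSimpleModule R (Q ⧸ m) := isSimpleModule_iff_isCoatom.2 hm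
  obtain ⟨l, ⟨e⟩⟩ := hL.complete (Q ⧸ m) hsm
  refine ⟨l, hQ.equiv_of_surjective (hP l) (g := e.toLinearMap ∘ₗ m.mkQ)
    (e.surjective.comp m.mkQ_surjective), ?_⟩
  rintro l' ⟨e'⟩
  obtain ⟨_, f, hf, hs⟩ := hP l'
  have hne : (e.toLinearMap ∘ₗ m.mkQ) ∘ₗ e'.symm.toLinearMap ≠ 0 := by
    intro h0
    have hsur : Function.Surjective ((e.toLinearMap ∘ₗ m.mkQ) ∘ₗ e'.symm.toLinearMap) :=
      (e.surjective.comp m.mkQ_surjective).comp e'.symm.surjective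
    have := IsSimpleModule.nontrivial R (L l)
    obtain ⟨y, hy⟩ := exists_ne (0 : L l)
    obtain ⟨x, hx⟩ := hsur y
    rw [h0] at hx
    exact hy hx.symm
  obtain ⟨e2, -⟩ := exists_equiv_of_superfluous hf hs hne
  exact hL.irredundant _ _ ⟨e2⟩

/-! ### The radical series -/

theorem radSeries_antitone (A M : Type*) [Ring A] [AddCommGroup M] [Module A M] :
    Antitone (radSeries A M) :=
  antitone_nat_of_succ_le fun n => by
    rintro _ ⟨y, -, rfl⟩
    exact y.2

theorem radSeries_eq_bot_of_isSimpleModule {A M : Type*} [Ring A] [AddCommGroup M] [Module A M]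
    [IsSimpleModule A M] {s : ℕ} (hs : 1 ≤ s) : radSeries A M s = ⊥ := by
  refine le_bot_iff.1 ((radSeries_antitone A M hs).trans ?_)
  rintro _ ⟨y, hy, rfl⟩
  have h := Module.le_comap_jacobson (radSeries A M 0).subtype hy
  rw [IsSimpleModule.jacobson_eq_bot] at h
  exact h

theorem smul_mem_radSeries {A M : Type*} [Ring A] [AddCommGroup M] [Module A M] {s : ℕ} {a : A}
    (ha : a ∈ radSeries A A s) (x : M) : a • x ∈ radSeries A M s :=
  radSeries_le_comap (LinearMap.toSpanSingleton A M x) s ha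

theorem isTorsionBySet_radSeries_of_simple {A M : Type*} [Ring A] [AddCommGroup M] [Module A M]
    [IsSimpleModule A M] {s : ℕ} (hs : 1 ≤ s) :
    Module.IsTorsionBySet A M (radSeries A A s : Ideal A) := by
  rintro x ⟨a, ha⟩
  have h := smul_mem_radSeries ha x
  rw [radSeries_eq_bot_of_isSimpleModule hs] at h
  exact h

theorem isTorsionBySet_quotient_radSeries (A M : Type*) [Ring A] [AddCommGroup M] [Module A M]
    (s : ℕ) : Module.IsTorsionBySet A (M ⧸ radSeries A M s) (radSeries A A s : Ideal A) := by
  rintro x ⟨a, ha⟩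
  obtain ⟨x, rfl⟩ := Submodule.Quotient.mk_surjective _ x
  exact (Submodule.Quotient.mk_eq_zero _).2 (smul_mem_radSeries ha x)

theorem isSemisimpleModule_quotient_jacobson_smul_top (A M : Type*) [Ring A] [IsArtinianRing A]
    [AddCommGroup M] [Module A M] :
    IsSemisimpleModule A (M ⧸ Ring.jacobson A • (⊤ : Submodule A M)) := by
  have h : Module.IsTorsionBySet A (M ⧸ Ring.jacobson A • (⊤ : Submodule A M))
      (Ring.jacobson A) := by
    rintro x ⟨a, ha⟩
    obtain ⟨x, rfl⟩ := Submodule.Quotient.mk_surjective _ x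
    exact (Submodule.Quotient.mk_eq_zero _).2 (Submodule.smul_mem_smul ha trivial)
  let := h.module
  exact h.isSemisimpleModule_iff.1 inferInstance

/-- Over an Artinian ring `M / J M` is a module over the semisimple ring `A / J`, so its radical
vanishes; no finiteness of `M` is needed. This turns the radical series into multiplication by
powers of `J`. -/
theorem jacobson_eq_smul_top (A M : Type*) [Ring A] [IsArtinianRing A] [AddCommGroup M]
    [Module A M] : Module.jacobson A M = Ring.jacobson A • (⊤ : Submodule A M) := by
  have := isSemisimpleModule_quotient_jacobson_smul_top A M
  exact le_antisymm (Module.jacobson_le_of_eq_bot (IsSemisimpleModule.jacobson_eq_bot _ _))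
    (Ring.jacobson_smul_top_le A M)

theorem radSeries_succ (A M : Type*) [Ring A] [IsArtinianRing A] [AddCommGroup M]
    [Module A M] (n : ℕ) : radSeries A M (n + 1) = Ring.jacobson A • radSeries A M n := by
  rw [radSeries, jacobson_eq_smul_top, Submodule.map_smul'', Submodule.map_top,
    Submodule.range_subtype]

theorem radSeries_self_eq_pow (A : Type*) [Ring A] [IsArtinianRing A] (n : ℕ) :
    (radSeries A A n : Ideal A) = Ring.jacobson A ^ n := by
  induction n with
  | zero => rw [Submodule.pow_zero, Ideal.one_eq_top]; rfl
  | succ n ih => rw [radSeries_succ, ih, Ideal.IsTwoSided.pow_succ]; rfl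

/-- The recursion multiplies by `J` on the left. The version with `J` on the right is needed because
an anti-involution reverses products. -/
theorem mul_mem_radSeries_self {A : Type*} [Ring A] [IsArtinianRing A] {n : ℕ} {a b : A}
    (ha : a ∈ radSeries A A n) (hb : b ∈ Ring.jacobson A) : a * b ∈ radSeries A A (n + 1) := by
  have h : a ∈ (radSeries A A n : Ideal A) := ha
  change a * b ∈ (radSeries A A (n + 1) : Ideal A)
  rw [radSeries_self_eq_pow] at h ⊢
  rw [Submodule.pow_succ]
  exact Ideal.mul_mem_mul h hb

/-! ### Modules over a quotient ring -/

section Quotient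

variable {A B : Type*} [Ring A] [Ring B] {σ : A →+* B}

/-- Along an epimorphism `A → B`, an `A`-linear map between `B`-modules is `B`-linear. -/
def LinearMap.toQuotientRing (hσ : Function.Surjective σ) {M N : Type*}
    [AddCommGroup M] [Module A M] [Module B M] [AddCommGroup N] [Module A N] [Module B N]
    (hM : ∀ (a : A) (x : M), σ a • x = a • x) (hN : ∀ (a : A) (x : N), σ a • x = a • x)
    (f : M →ₗ[A] N) : M →ₗ[B] N where
  toFun := f
  map_add' := f.map_add
  map_smul' b x := by
    obtain ⟨a, rfl⟩ := hσ b
    simp [hM, hN]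

/-- A `B`-linear map is `A`-linear. -/
def LinearMap.ofQuotientRing {M N : Type*}
    [AddCommGroup M] [Module A M] [Module B M] [AddCommGroup N] [Module A N] [Module B N]
    (hM : ∀ (a : A) (x : M), σ a • x = a • x) (hN : ∀ (a : A) (x : N), σ a • x = a • x)
    (f : M →ₗ[B] N) : M →ₗ[A] N where
  toFun := f
  map_add' := f.map_add
  map_smul' a x := by simp [← hM, ← hN]

/-- A `B`-submodule, as an `A`-submodule. -/
def Submodule.ofQuotientRing {M : Type*} [AddCommGroup M] [Module A M] [Module B M]
    (hM : ∀ (a : A) (x : M), σ a • x = a • x) (N : Submodule B M) : Submodule A M where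
  toAddSubmonoid := N.toAddSubmonoid
  smul_mem' a x hx := by
    rw [← hM]
    exact N.smul_mem _ hx

theorem isSimpleModule_iff_of_surjective (hσ : Function.Surjective σ)
    {M : Type*} [AddCommGroup M] [Module A M] [Module B M]
    (hM : ∀ (a : A) (x : M), σ a • x = a • x) : IsSimpleModule A M ↔ IsSimpleModule B M :=
  have : RingHomSurjective σ := ⟨hσ⟩
  LinearMap.isSimpleModule_iff_of_bijective
    ({ toFun := id, map_add' := fun _ _ => rfl, map_smul' := fun a x => (hM a x).symm } :
      M →ₛₗ[σ] M) Function.bijective_id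

theorem superfluous_of_surjective {M N : Type*}
    [AddCommGroup M] [Module A M] [Module B M] [AddCommGroup N] [Module A N] [Module B N]
    (hM : ∀ (a : A) (x : M), σ a • x = a • x) {f : M →ₗ[A] N}
    (hs : ∀ K : Submodule A M, K ⊔ LinearMap.ker f = ⊤ → K = ⊤)
    {g : M →ₗ[B] N} (hg : ∀ x, g x = f x)
    (K : Submodule B M) (hK : K ⊔ LinearMap.ker g = ⊤) : K = ⊤ := by
  have key : K.ofQuotientRing hM = ⊤ := by
    apply hs
    rw [eq_top_iff]
    intro x _
    have hx : x ∈ K ⊔ LinearMap.ker g := by rw [hK]; exact Submodule.mem_top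
    obtain ⟨y, hy, z, hz, hyz⟩ := Submodule.mem_sup.1 hx
    rw [LinearMap.mem_ker, hg] at hz
    have hy' : y ∈ K.ofQuotientRing hM := hy
    rw [← hyz]
    exact Submodule.add_mem_sup hy' (LinearMap.mem_ker.2 hz)
  refine eq_top_iff.2 fun x _ => ?_
  have hx : x ∈ K.ofQuotientRing hM := by rw [key]; exact Submodule.mem_top
  exact hx

end Quotient

theorem IsCompleteListOfSimples.of_surjective {A B : Type u} [Ring A] [Ring B] {σ : A →+* B}
    (hσ : Function.Surjective σ) {Λ : Type*} {L : Λ → Type u} [∀ l, AddCommGroup (L l)]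
    [∀ l, Module A (L l)] [∀ l, Module B (L l)] (hL : IsCompleteListOfSimples A L)
    (h : ∀ (l : Λ) (a : A) (x : L l), σ a • x = a • x) :
    IsCompleteListOfSimples B L where
  simple l := (isSimpleModule_iff_of_surjective hσ (h l)).1 (hL.simple l)
  irredundant l m := fun ⟨e⟩ => hL.irredundant l m
    ⟨.ofBijective (e.toLinearMap.ofQuotientRing (h l) (h m)) e.bijective⟩
  complete S _ _ hS := by
    let : Module A S := Module.compHom S σ
    have hc : ∀ (a : A) (x : S), σ a • x = a • x := fun _ _ => rfl
    obtain ⟨l, ⟨e⟩⟩ := hL.complete S ((isSimpleModule_iff_of_surjective hσ hc).2 hS)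
    exact ⟨l, ⟨.ofBijective (e.toLinearMap.toQuotientRing hσ hc (h l)) e.bijective⟩⟩

/-- The image of a superfluous kernel under an epimorphism is superfluous. -/
theorem superfluous_of_comp {A P Q L : Type*} [Ring A] [AddCommGroup P] [Module A P]
    [AddCommGroup Q] [Module A Q] [AddCommGroup L] [Module A L] {q : P →ₗ[A] Q} {f : Q →ₗ[A] L}
    (hq : Function.Surjective q)
    (hs : ∀ N : Submodule A P, N ⊔ LinearMap.ker (f ∘ₗ q) = ⊤ → N = ⊤)
    (N : Submodule A Q) (hN : N ⊔ LinearMap.ker f = ⊤) : N = ⊤ := by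
  have key : N.comap q = ⊤ := by
    apply hs
    rw [LinearMap.ker_comp, eq_top_iff]
    intro x _
    obtain ⟨y, hy, z, hz, hyz⟩ := Submodule.mem_sup.1 (hN.ge (Submodule.mem_top (x := q x)))
    obtain ⟨y, rfl⟩ := hq y
    have : z = q (x - y) := by rw [map_sub, ← hyz]; abel
    rw [this] at hz
    exact Submodule.mem_sup.2 ⟨y, hy, x - y, hz, by abel⟩
  rw [eq_top_iff]
  intro x _
  obtain ⟨x, rfl⟩ := hq x
  exact key.ge (Submodule.mem_top (x := x))

/-- Homomorphisms respect the radical series, so a splitting of `P` off `A` induces a splitting of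
`P / rad^s P` off `A / rad^s A`. The map to `L` descends since `rad^s L = 0` for `s ≥ 1`. -/
theorem IsProjectiveCover.radQuotient {A P L : Type*} [Ring A] [AddCommGroup P] [Module A P]
    [AddCommGroup L] [Module A L] [IsSimpleModule A L] {s : ℕ} (hs : 1 ≤ s)
    [Module (RadQuotient A s) L] [Module (RadQuotient A s) (P ⧸ radSeries A P s)]
    (h : IsProjectiveCover A P L)
    (hL : ∀ (a : A) (x : L), (Ideal.Quotient.mk (radSeries A A s : Ideal A) a) • x = a • x)
    (hP : ∀ (a : A) (x : P ⧸ radSeries A P s),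
      (Ideal.Quotient.mk (radSeries A A s : Ideal A) a) • x = a • x) :
    IsProjectiveCover (RadQuotient A s) (P ⧸ radSeries A P s) L := by
  obtain ⟨i, r, hir⟩ := h.exists_split
  obtain ⟨-, f, hf, hsup⟩ := h
  have hB : ∀ (a : A) (x : RadQuotient A s),
      (Ideal.Quotient.mk (radSeries A A s : Ideal A) a) • x = a • x := by
    intro a x
    obtain ⟨x, rfl⟩ := Ideal.Quotient.mk_surjective x
    rfl
  constructor
  · let i' : P ⧸ radSeries A P s →ₗ[A] RadQuotient A s :=
      Submodule.mapQ _ (radSeries A A s) i (radSeries_le_comap i s)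
    let r' : RadQuotient A s →ₗ[A] P ⧸ radSeries A P s :=
      Submodule.mapQ (radSeries A A s) _ r (radSeries_le_comap r s)
    refine .of_split (i'.toQuotientRing Ideal.Quotient.mk_surjective hP hB)
      (r'.toQuotientRing Ideal.Quotient.mk_surjective hB hP)
      (LinearMap.ext fun x => ?_)
    obtain ⟨x, rfl⟩ := Submodule.Quotient.mk_surjective _ x
    exact congrArg Submodule.Quotient.mk (LinearMap.congr_fun hir x)
  · have hk : radSeries A P s ≤ LinearMap.ker f := by
      intro x hx
      have := radSeries_le_comap f s hx
      rwa [radSeries_eq_bot_of_isSimpleModule hs] at this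
    let f' := (radSeries A P s).liftQ f hk
    have hf' : f' ∘ₗ (radSeries A P s).mkQ = f := Submodule.liftQ_mkQ _ _ _
    refine ⟨f'.toQuotientRing Ideal.Quotient.mk_surjective hP hL, fun y => ?_,
      superfluous_of_surjective hP (f := f') ?_
      fun _ => rfl⟩
    · obtain ⟨x, rfl⟩ := hf y
      exact ⟨Submodule.Quotient.mk x, rfl⟩
    · refine superfluous_of_comp (q := (radSeries A P s).mkQ) (Submodule.mkQ_surjective _) ?_
      rwa [hf']

/-! ### The Cartan matrix from a symmetric form -/

theorem Fin.eq_sum_of_succ_eq_add {n : ℕ} (g : Fin (n + 1) → ℕ) (d : Fin n → ℕ) (h0 : g 0 = 0)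
    (hs : ∀ i : Fin n, g i.succ = g i.castSucc + d i) : g (Fin.last n) = ∑ i, d i := by
  induction n with
  | zero => simpa using h0
  | succ n ih =>
    rw [Fin.sum_univ_castSucc, ← Fin.succ_last, hs,
      ih (fun i => g i.castSucc) (fun i => d i.castSucc) h0 fun i => hs i.castSucc]

section Form

variable {B : Type u} [Ring B] {Λ : Type*} {L P : Λ → Type u}
  [∀ l, AddCommGroup (L l)] [∀ l, Module B (L l)] [∀ l, AddCommGroup (P l)] [∀ l, Module B (P l)]
  (h : ∀ (M N : Type u) [AddCommGroup M] [Module B M] [AddCommGroup N] [Module B N], ℕ)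

/-- A function which is additive on short exact sequences and takes the value `1` on `L m` and the
value `0` on the other simple modules computes composition multiplicities. -/
theorem compMultiplicity_eq_of_additive [IsArtinianRing B] (hL : IsCompleteListOfSimples B L)
    (φ : ∀ (N : Type u) [AddCommGroup N] [Module B N], ℕ)
    (add : ∀ (X Y Z : Type u) [AddCommGroup X] [Module B X] [AddCommGroup Y]
      [Module B Y] [AddCommGroup Z] [Module B Z], Module.Finite B X → Module.Finite B Y →
      Module.Finite B Z → ∀ (f : X →ₗ[B] Y) (g : Y →ₗ[B] Z), Function.Injective f →
        Function.Exact f g → Function.Surjective g → φ Y = φ X + φ Z)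
    (m : Λ) (same : φ (L m) = 1) (diff : ∀ l, l ≠ m → φ (L l) = 0)
    (M : Type u) [AddCommGroup M] [Module B M] [Module.Finite B M] :
    compMultiplicity B M (L m) = φ M := by
  -- Exactness of `0 → 0 → 0` gives `φ 0 = φ 0 + φ 0`; invariance under isomorphism then follows
  -- from `X ≅ Y → 0`.
  have hzero : φ PUnit.{u+1} = 0 := by
    have := add PUnit PUnit PUnit inferInstance inferInstance inferInstance LinearMap.id 0
      Function.injective_id (fun x => ⟨fun _ => ⟨x, rfl⟩, fun _ => rfl⟩) fun x => ⟨x, rfl⟩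
    omega
  have hiso : ∀ (X Y : Type u) [AddCommGroup X] [Module B X] [AddCommGroup Y] [Module B Y],
      Module.Finite B X → ∀ e : X ≃ₗ[B] Y, φ X = φ Y := by
    intro X Y _ _ _ _ hX e
    have hY : Module.Finite B Y := Module.Finite.equiv e
    have := add X Y PUnit.{u+1} hX hY inferInstance e.toLinearMap 0 e.injective
      (fun x => ⟨fun _ => ⟨e.symm x, by simp⟩, fun _ => rfl⟩) fun x => ⟨0, rfl⟩
    omega
  have hex : ∃ c : CompositionSeries (Submodule B M), c.head = ⊥ ∧ c.last = ⊤ :=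
    exists_compositionSeries_of_isNoetherian_isArtinian B M
  rw [compMultiplicity, dif_pos hex]
  obtain ⟨h0, h1⟩ := hex.choose_spec
  generalize hex.choose = c at h0 h1 ⊢
  -- Along the composition series `φ` telescopes into the sum of its values on the simple factors.
  have key := Fin.eq_sum_of_succ_eq_add (fun i => φ (c i))
    (fun i => φ (↥(c i.succ) ⧸ (c i.castSucc).submoduleOf (c i.succ))) ?_ ?_
  · have hlast : φ (c (Fin.last _)) = φ M := by
      refine hiso _ _ inferInstance (LinearEquiv.ofTop _ h1)
    rw [← hlast, key, seriesMultiplicity, Finset.card_filter]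
    refine Finset.sum_congr rfl fun i _ => ?_
    have hs : IsSimpleModule B (↥(c i.succ) ⧸ (c i.castSucc).submoduleOf (c i.succ)) :=
      (covBy_iff_quot_is_simple (c.step i).le).1 (c.step i)
    obtain ⟨l, ⟨e⟩⟩ := hL.complete _ hs
    rw [hiso _ _ inferInstance e]
    split_ifs with hm
    · obtain ⟨e'⟩ := hm
      rw [hL.irredundant l m ⟨e.symm.trans e'⟩, same]
    · refine (diff l fun hlm => hm ?_).symm
      subst hlm
      exact ⟨e⟩
  · have : c 0 = ⊥ := h0
    change φ (c 0) = 0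
    rw [hiso (c 0) PUnit.{u+1} inferInstance ((LinearEquiv.ofEq _ _ this).trans
      (Submodule.botEquivPUnit)), hzero]
  · intro i
    have hle : c i.castSucc ≤ c i.succ := (c.step i).le
    refine add _ _ _ inferInstance inferInstance inferInstance (Submodule.inclusion hle)
      (Submodule.mkQ _) (Submodule.inclusion_injective hle) (fun x => ?_)
      (Submodule.mkQ_surjective _)
    rw [Submodule.mkQ_apply, Submodule.Quotient.mk_eq_zero, Submodule.submoduleOf,
      Submodule.mem_comap]
    exact ⟨fun hx => ⟨⟨x, hx⟩, rfl⟩, by rintro ⟨y, rfl⟩; exact y.2⟩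

/-- The Cartan matrix is symmetric as soon as there is a symmetric function `h` of two modules such
that `h (P l)` is additive and `h (P l) (L m)` is `1` for `l = m` and `0` otherwise. -/
theorem algCartanMatrix_isSymm_of_form [IsArtinianRing B] (hL : IsCompleteListOfSimples B L)
    (fin : ∀ l, Module.Finite B (P l))
    (symm : ∀ (M N : Type u) [AddCommGroup M] [Module B M] [AddCommGroup N] [Module B N],
      Module.Finite B M → Module.Finite B N → h M N = h N M)
    (add : ∀ (l : Λ) (X Y Z : Type u) [AddCommGroup X] [Module B X] [AddCommGroup Y]
      [Module B Y] [AddCommGroup Z] [Module B Z], Module.Finite B X → Module.Finite B Y →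
      Module.Finite B Z → ∀ (f : X →ₗ[B] Y) (g : Y →ₗ[B] Z), Function.Injective f →
        Function.Exact f g → Function.Surjective g → h (P l) Y = h (P l) X + h (P l) Z)
    (same : ∀ l, h (P l) (L l) = 1) (diff : ∀ l m, l ≠ m → h (P l) (L m) = 0) :
    (algCartanMatrix B P L).IsSymm := by
  have key : ∀ l m, compMultiplicity B (P l) (L m) = h (P m) (P l) := fun l m =>
    compMultiplicity_eq_of_additive hL (fun N _ _ => h (P m) N) (add m) m (same m)
      (fun l hl => diff m l hl.symm) (P l)
  ext l m
  simp only [Matrix.transpose_apply, algCartanMatrix, Matrix.of_apply, key]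
  exact symm _ _ (fin l) (fin m)

end Form

/-! ### Dimensions of spaces of homomorphisms -/

section Hom

variable {k B : Type*} [Field k] [Ring B] [Algebra k B]

theorem finite_linearMap (M N : Type*) [AddCommGroup M] [Module B M] [Module.Finite B M]
    [AddCommGroup N] [Module B N] [Module k N] [IsScalarTower k B N] [Module.Finite k N] :
    Module.Finite k (M →ₗ[B] N) := by
  obtain ⟨n, f, hf⟩ := Module.Finite.exists_fin' B M
  let ev : (M →ₗ[B] N) →ₗ[k] (Fin n → N) :=
    { toFun := fun g i => g (f (Pi.single i 1))
      map_add' := fun _ _ => rfl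
      map_smul' := fun _ _ => rfl }
  refine Module.Finite.of_injective ev fun g g' hg => ?_
  have : g ∘ₗ f = g' ∘ₗ f := by
    ext i
    exact congrFun hg i
  exact LinearMap.ext fun x => by
    obtain ⟨y, rfl⟩ := hf x
    exact LinearMap.congr_fun this y

/-- Lifting along `g` is assumed instead of projectivity of `P` over `B`, so that the lemma also
applies to `A`-homomorphisms from a module that is projective only over a quotient of `A`. -/
theorem finrank_hom_eq_add {P : Type*} [AddCommGroup P] [Module B P] [Module.Finite B P]
    {X Y Z : Type*} [AddCommGroup X] [Module B X] [Module k X] [IsScalarTower k B X]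
    [AddCommGroup Y] [Module B Y] [Module k Y] [IsScalarTower k B Y]
    [AddCommGroup Z] [Module B Z] [Module k Z] [IsScalarTower k B Z]
    [Module.Finite k Y] (f : X →ₗ[B] Y) (g : Y →ₗ[B] Z)
    (hf : Function.Injective f) (hfg : Function.Exact f g)
    (lift : ∀ t : P →ₗ[B] Z, ∃ t' : P →ₗ[B] Y, g ∘ₗ t' = t) :
    Module.finrank k (P →ₗ[B] Y) = Module.finrank k (P →ₗ[B] X) + Module.finrank k (P →ₗ[B] Z) := by
  have := finite_linearMap (k := k) (B := B) P Y
  let G : (P →ₗ[B] Y) →ₗ[k] (P →ₗ[B] Z) :=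
    { toFun := fun t => g ∘ₗ t
      map_add' := fun _ _ => LinearMap.comp_add _ _ _
      map_smul' := fun c t => by
        ext x
        exact (g.map_smul_of_tower c (t x)) }
  let F : (P →ₗ[B] X) →ₗ[k] (P →ₗ[B] Y) :=
    { toFun := fun t => f ∘ₗ t
      map_add' := fun _ _ => LinearMap.comp_add _ _ _
      map_smul' := fun c t => by
        ext x
        exact (f.map_smul_of_tower c (t x)) }
  have hF : Function.Injective F := fun t t' htt => by
    ext x
    exact hf (LinearMap.congr_fun htt x)
  have hG : LinearMap.range G = ⊤ := LinearMap.range_eq_top.2 lift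
  have hFG : LinearMap.ker G = LinearMap.range F := by
    ext t
    constructor
    · intro ht
      have h1 : ∀ x, t x ∈ LinearMap.range f := fun x =>
        (hfg _).1 (LinearMap.congr_fun ht x)
      refine ⟨(LinearEquiv.ofInjective f hf).symm.toLinearMap ∘ₗ t.codRestrict _ h1, ?_⟩
      ext x
      exact congrArg Subtype.val
        ((LinearEquiv.ofInjective f hf).apply_symm_apply (t.codRestrict _ h1 x))
    · rintro ⟨t, rfl⟩
      ext x
      exact (hfg _).2 ⟨_, rfl⟩
  have h1 := LinearMap.finrank_range_add_finrank_ker G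
  rw [hG, hFG, finrank_top, LinearMap.finrank_range_of_inj hF] at h1
  omega

/-- Homomorphisms from a module which covers `L` to a simple module, in terms of endomorphisms
of `L`. -/
theorem finrank_hom_superfluous {P L S : Type*} [AddCommGroup P] [Module B P]
    [AddCommGroup L] [Module B L] [IsSimpleModule B L]
    [AddCommGroup S] [Module B S] [Module k S] [IsScalarTower k B S]
    {f : P →ₗ[B] L} (hf : Function.Surjective f)
    (hs : ∀ N : Submodule B P, N ⊔ LinearMap.ker f = ⊤ → N = ⊤) (e : L ≃ₗ[B] S)
    (hend : ∀ f : L →ₗ[B] L, ∃ c : k, ∀ x, f x = algebraMap k B c • x) :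
    Module.finrank k (P →ₗ[B] S) = 1 := by
  have hS : IsSimpleModule B S := IsSimpleModule.congr e.symm
  have := IsSimpleModule.nontrivial B L
  refine finrank_eq_one (e.toLinearMap ∘ₗ f) ?_ fun w => ?_
  · intro h0
    obtain ⟨y, hy⟩ := exists_ne (0 : L)
    obtain ⟨x, rfl⟩ := hf y
    exact hy (e.injective ((LinearMap.congr_fun h0 x).trans (map_zero e).symm))
  · by_cases hw : w = 0
    · exact ⟨0, by rw [hw, zero_smul]⟩
    obtain ⟨e', he'⟩ := exists_equiv_of_superfluous hf hs hw
    -- Both `w` and `e ∘ f` factor through `f` by isomorphisms `L ≃ S`, which differ by an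
    -- endomorphism of `L`, hence by a scalar.
    obtain ⟨c, hc⟩ := hend (e.symm.toLinearMap ∘ₗ e'.toLinearMap)
    refine ⟨c, ?_⟩
    rw [← he']
    ext x
    have h2 : e.symm (e' (f x)) = algebraMap k B c • f x := hc (f x)
    rw [LinearEquiv.symm_apply_eq, map_smul, algebraMap_smul] at h2
    exact h2.symm

theorem finrank_hom_superfluous_eq_zero {P L S : Type*} [AddCommGroup P] [Module B P]
    [AddCommGroup L] [Module B L] [IsSimpleModule B L]
    [AddCommGroup S] [Module B S] [IsSimpleModule B S] [Module k S] [IsScalarTower k B S]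
    {f : P →ₗ[B] L} (hf : Function.Surjective f)
    (hs : ∀ N : Submodule B P, N ⊔ LinearMap.ker f = ⊤ → N = ⊤) (h : ¬ Nonempty (L ≃ₗ[B] S)) :
    Module.finrank k (P →ₗ[B] S) = 0 := by
  have : Subsingleton (P →ₗ[B] S) := subsingleton_of_forall_eq 0 fun w => by
    by_contra hw
    obtain ⟨e, -⟩ := exists_equiv_of_superfluous hf hs hw
    exact h ⟨e⟩
  exact Module.finrank_zero_of_subsingleton

end Hom

/-! ### Anti-involutions and twisted duals -/

/-- A `k`-linear anti-automorphism of order two. -/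
structure AntiInvolution (k B : Type*) [Field k] [Ring B] [Algebra k B] where
  /-- The underlying linear map. -/
  map : B →ₗ[k] B
  map_mul : ∀ a b, map (a * b) = map b * map a
  map_map : ∀ a, map (map a) = a

namespace AntiInvolution

section Field

variable {k B : Type*} [Field k] [Ring B] [Algebra k B] (ι : AntiInvolution k B)

theorem map_one : ι.map 1 = 1 := by
  have h := ι.map_mul (ι.map 1) 1
  rwa [mul_one, ι.map_map, mul_one, eq_comm] at h

/-- The dual space of a `B`-module, as a `B`-module through the anti-involution. -/
def TwistedDual (_ι : AntiInvolution k B) (N : Type*) [AddCommGroup N] [Module k N] : Type _ :=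
  Module.Dual k N

section TwistedDual

variable (N : Type*) [AddCommGroup N] [Module k N]

instance : AddCommGroup (ι.TwistedDual N) := inferInstanceAs (AddCommGroup (Module.Dual k N))

instance : Module k (ι.TwistedDual N) := inferInstanceAs (Module k (Module.Dual k N))

instance [Module.Finite k N] : Module.Finite k (ι.TwistedDual N) :=
  inferInstanceAs (Module.Finite k (Module.Dual k N))

/-- An element of the twisted dual, as a linear form. -/
def TwistedDual.form {ι : AntiInvolution k B} {N : Type*} [AddCommGroup N] [Module k N] :
    ι.TwistedDual N ≃ₗ[k] Module.Dual k N := LinearEquiv.refl _ _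

variable [Module B N] [IsScalarTower k B N]

instance : Module B (ι.TwistedDual N) where
  smul a ξ := TwistedDual.form.symm (TwistedDual.form ξ ∘ₗ Algebra.lsmul k k N (ι.map a))
  one_smul ξ := LinearMap.ext fun x => by
    change TwistedDual.form ξ (ι.map 1 • x) = TwistedDual.form ξ x
    rw [ι.map_one, one_smul]
  mul_smul a b ξ := LinearMap.ext fun x => by
    change TwistedDual.form ξ (ι.map (a * b) • x) = TwistedDual.form ξ (ι.map b • ι.map a • x)
    rw [ι.map_mul, mul_smul]
  smul_zero a := rfl
  zero_smul ξ := LinearMap.ext fun x => by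
    change TwistedDual.form ξ (ι.map 0 • x) = 0
    rw [map_zero, zero_smul, map_zero]
  smul_add a ξ ζ := rfl
  add_smul a b ξ := LinearMap.ext fun x => by
    change TwistedDual.form ξ (ι.map (a + b) • x) =
      TwistedDual.form ξ (ι.map a • x) + TwistedDual.form ξ (ι.map b • x)
    rw [map_add, add_smul, map_add]

theorem TwistedDual.form_smul (a : B) (ξ : ι.TwistedDual N) (x : N) :
    TwistedDual.form (a • ξ) x = TwistedDual.form ξ (ι.map a • x) := rfl

instance : IsScalarTower k B (ι.TwistedDual N) where
  smul_assoc c a ξ := LinearMap.ext fun x => by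
    change TwistedDual.form ξ (ι.map (c • a) • x) = c • TwistedDual.form ξ (ι.map a • x)
    rw [ι.map.map_smul, smul_assoc]
    exact (TwistedDual.form ξ).map_smul _ _

end TwistedDual

variable {M N : Type*} [AddCommGroup M] [Module k M] [Module B M] [IsScalarTower k B M]
  [AddCommGroup N] [Module k N] [Module B N] [IsScalarTower k B N]

/-- The transpose of a homomorphism. -/
def dualMap (f : M →ₗ[B] N) : ι.TwistedDual N →ₗ[B] ι.TwistedDual M where
  toFun ξ := TwistedDual.form.symm (TwistedDual.form ξ ∘ₗ f.restrictScalars k)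
  map_add' _ _ := rfl
  map_smul' a ξ := LinearMap.ext fun x =>
    congrArg (TwistedDual.form ξ) (f.map_smul (ι.map a) x).symm

/-- A homomorphism from `M` to the twisted dual of `N`, seen as a homomorphism from `N` to the
twisted dual of `M`. Both are invariant bilinear forms on `M × N`. -/
def homFlip : (M →ₗ[B] ι.TwistedDual N) →ₗ[k] (N →ₗ[B] ι.TwistedDual M) where
  toFun t :=
    { toFun := fun y => TwistedDual.form.symm
        { toFun := fun x => TwistedDual.form (t x) y
          map_add' := fun x x' => by rw [map_add, map_add]; rfl
          map_smul' := fun c x => by rw [t.map_smul_of_tower, map_smul]; rfl }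
      map_add' := fun y y' => LinearMap.ext fun x => (TwistedDual.form (t x)).map_add y y'
      map_smul' := fun a y => LinearMap.ext fun x => by
        change TwistedDual.form (t x) (a • y) = TwistedDual.form (t (ι.map a • x)) y
        rw [t.map_smul, TwistedDual.form_smul, ι.map_map] }
  map_add' _ _ := rfl
  map_smul' _ _ := rfl

variable (M N) in
/-- The bijection between homomorphisms to twisted duals. -/
def homTwistedDualEquiv : (M →ₗ[B] ι.TwistedDual N) ≃ₗ[k] (N →ₗ[B] ι.TwistedDual M) where
  toLinearMap := ι.homFlip
  invFun := ι.homFlip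
  left_inv _ := rfl
  right_inv _ := rfl

theorem dualMap_injective {f : M →ₗ[B] N} (hf : Function.Surjective f) :
    Function.Injective (ι.dualMap f) := fun ξ ζ h => LinearMap.ext fun x => by
  obtain ⟨x, rfl⟩ := hf x
  exact LinearMap.congr_fun h x

theorem dualMap_surjective {f : M →ₗ[B] N} (hf : Function.Injective f) :
    Function.Surjective (ι.dualMap f) :=
  LinearMap.dualMap_surjective_of_injective (f := f.restrictScalars k) hf

theorem dualMap_exact {X : Type*} [AddCommGroup X] [Module k X] [Module B X] [IsScalarTower k B X]
    {f : X →ₗ[B] M} {g : M →ₗ[B] N} (hfg : Function.Exact f g) (hg : Function.Surjective g) :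
    Function.Exact (ι.dualMap g) (ι.dualMap f) := by
  have h1 := LinearMap.ker_dualMap_eq_dualAnnihilator_range (f.restrictScalars k)
  have h2 := LinearMap.range_dualMap_eq_dualAnnihilator_ker_of_surjective (g.restrictScalars k) hg
  have h3 : LinearMap.ker (g.restrictScalars k) = LinearMap.range (f.restrictScalars k) :=
    Submodule.ext hfg
  rw [h3, ← h1] at h2
  intro ξ
  exact (SetLike.ext_iff.1 h2 ξ).symm

/-- A nonzero bilinear form on a module for which the anti-involution gives the adjoint. -/
def HasInvariantForm (L : Type*) [AddCommGroup L] [Module B L] : Prop :=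
  ∃ θ : L →+ L →+ k, θ ≠ 0 ∧ (∀ (a : B) (x y : L), θ (a • x) y = θ x (ι.map a • y)) ∧
    ∀ (c : k) (x y : L), θ x (algebraMap k B c • y) = c * θ x y

/-- The form is a nonzero homomorphism from `N` to its twisted dual. It is injective because `N` is
simple, and the dimensions agree. -/
theorem HasInvariantForm.equiv [Module.Finite k N] [IsSimpleModule B N]
    (h : ι.HasInvariantForm N) : Nonempty (N ≃ₗ[B] ι.TwistedDual N) := by
  obtain ⟨θ, h0, h1, h2⟩ := h
  let t : N →ₗ[B] ι.TwistedDual N :=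
    { toFun := fun x => TwistedDual.form.symm
        { toFun := θ x
          map_add' := (θ x).map_add
          map_smul' := fun c y => by
            rw [← algebraMap_smul B, h2]; rfl }
      map_add' := fun x y => LinearMap.ext fun z => by
        change θ (x + y) z = θ x z + θ y z
        rw [map_add]; rfl
      map_smul' := fun a x => LinearMap.ext fun y => h1 a x y }
  have ht : t ≠ 0 := by
    rintro ht
    apply h0
    ext x y
    exact LinearMap.congr_fun (LinearMap.congr_fun ht x) y
  have hinj : Function.Injective t := LinearMap.injective_of_ne_zero ht
  have hfr : Module.finrank k N = Module.finrank k (ι.TwistedDual N) :=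
    (Subspace.dual_finrank_eq (K := k) (V := N)).symm
  exact ⟨LinearEquiv.ofBijective t
    ⟨hinj, (LinearMap.injective_iff_surjective_of_finrank_eq_finrank
      (f := t.restrictScalars k) hfr).1 hinj⟩⟩

/-- The right radical of the form is a proper submodule, hence zero, and `θ x (ι a • y) = θ (a • x)
y = 0`. So the annihilator of a simple module with an invariant form is stable under the
anti-involution. -/
theorem HasInvariantForm.smul_eq_zero {S : Type*} [AddCommGroup S] [Module B S]
    [IsSimpleModule B S] (h : ι.HasInvariantForm S) {a : B} (ha : ∀ x : S, a • x = 0) (y : S) :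
    ι.map a • y = 0 := by
  obtain ⟨θ, h0, h1, -⟩ := h
  let K : Submodule B S :=
    { carrier := {y | ∀ x, θ x y = 0}
      add_mem' := fun {y z} hy hz x => by rw [map_add, hy x, hz x, add_zero]
      zero_mem' := fun x => map_zero _
      smul_mem' := fun b y hy x => by rw [← ι.map_map b, ← h1, hy] }
  have hK : K = ⊥ := (eq_bot_or_eq_top K).resolve_right fun hK => h0 (by
    ext x y
    have hy : y ∈ K := by rw [hK]; trivial
    exact hy x)
  have : ι.map a • y ∈ K := fun x => by rw [← h1, ha, map_zero]; rfl
  rwa [hK] at this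

/-- The anti-involution descends to quotients by invariant ideals. -/
theorem exists_quotient {B' : Type*} [Ring B'] [Algebra k B'] (σ : B →ₐ[k] B')
    (hσ : Function.Surjective σ) (h : ∀ a, σ a = 0 → σ (ι.map a) = 0) :
    ∃ ι' : AntiInvolution k B', ∀ a, ι'.map (σ a) = σ (ι.map a) := by
  -- The induced map is defined through a linear section `τ`; invariance of the kernel makes it
  -- independent of that choice.
  obtain ⟨τ, hτ⟩ := σ.toLinearMap.exists_rightInverse_of_surjective (LinearMap.range_eq_top.2 hσ)
  have key : ∀ a, σ (ι.map (τ (σ a))) = σ (ι.map a) := fun a => by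
    rw [← sub_eq_zero, ← map_sub, ← map_sub]
    apply h
    rw [map_sub, sub_eq_zero]
    exact LinearMap.congr_fun hτ (σ a)
  refine ⟨⟨σ.toLinearMap ∘ₗ ι.map ∘ₗ τ, fun a b => ?_, fun a => ?_⟩, key⟩
  · obtain ⟨a, rfl⟩ := hσ a
    obtain ⟨b, rfl⟩ := hσ b
    change σ (ι.map (τ (σ a * σ b))) = σ (ι.map (τ (σ b))) * σ (ι.map (τ (σ a)))
    rw [← _root_.map_mul σ, key, key, key, ι.map_mul, _root_.map_mul]
  · obtain ⟨a, rfl⟩ := hσ a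
    change σ (ι.map (τ (σ (ι.map (τ (σ a)))))) = σ a
    rw [key (ι.map (τ (σ a))), ι.map_map]
    exact LinearMap.congr_fun hτ (σ a)

end Field

/-- The Cartan matrix is symmetric if there is an anti-involution which fixes the simple
modules. -/
theorem algCartanMatrix_isSymm {k : Type*} {B : Type u} [Field k] [Ring B] [Algebra k B]
    [Module.Finite k B] (ι : AntiInvolution k B) {Λ : Type*} {L P : Λ → Type u}
    [∀ l, AddCommGroup (L l)] [∀ l, Module B (L l)] [∀ l, AddCommGroup (P l)]
    [∀ l, Module B (P l)] (hL : IsCompleteListOfSimples B L)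
    (hP : ∀ l, IsProjectiveCover B (P l) (L l))
    (hend : ∀ (l : Λ) (f : L l →ₗ[B] L l), ∃ c : k, ∀ x, f x = algebraMap k B c • x)
    (hform : ∀ l, ι.HasInvariantForm (L l)) :
    (algCartanMatrix B P L).IsSymm := by
  have := hL.simple
  have := fun l => (hP l).finite
  have : IsArtinianRing B := IsArtinianRing.of_finite k B
  have fin : ∀ (X : Type u) [AddCommGroup X] [Module B X] [Module k X] [IsScalarTower k B X]
      [Module.Finite B X], Module.Finite k X := fun X => Module.Finite.trans B X
  refine algCartanMatrix_isSymm_of_form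
    (fun M N _ _ _ _ =>
      letI : Module k M := Module.compHom M (algebraMap k B)
      letI : Module k N := Module.compHom N (algebraMap k B)
      haveI : IsScalarTower k B N := ⟨fun c a x => by rw [Algebra.smul_def, mul_smul]; rfl⟩
      Module.finrank k (M →ₗ[B] ι.TwistedDual N)) hL inferInstance ?_ ?_ ?_ ?_
  · intro M N _ _ _ _ _ _
    let : Module k M := Module.compHom M (algebraMap k B)
    let : Module k N := Module.compHom N (algebraMap k B)
    have : IsScalarTower k B M := ⟨fun c a x => by rw [Algebra.smul_def, mul_smul]; rfl⟩
    have : IsScalarTower k B N := ⟨fun c a x => by rw [Algebra.smul_def, mul_smul]; rfl⟩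
    exact (ι.homTwistedDualEquiv M N).finrank_eq
  · intro l X Y Z _ _ _ _ _ _ hX hY hZ f g hf hfg hg
    let : Module k X := Module.compHom X (algebraMap k B)
    let : Module k Y := Module.compHom Y (algebraMap k B)
    let : Module k Z := Module.compHom Z (algebraMap k B)
    have : IsScalarTower k B X := ⟨fun c a x => by rw [Algebra.smul_def, mul_smul]; rfl⟩
    have : IsScalarTower k B Y := ⟨fun c a x => by rw [Algebra.smul_def, mul_smul]; rfl⟩
    have : IsScalarTower k B Z := ⟨fun c a x => by rw [Algebra.smul_def, mul_smul]; rfl⟩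
    have := fin Y
    have := (hP l).1
    -- Dualizing reverses the sequence, so the two summands appear in the opposite order.
    exact (finrank_hom_eq_add _ _ (ι.dualMap_injective hg) (ι.dualMap_exact hfg hg)
      fun t => Module.projective_lifting_property _ t (ι.dualMap_surjective hf)).trans
        (add_comm _ _)
  · intro l
    let : Module k (L l) := Module.compHom (L l) (algebraMap k B)
    have : IsScalarTower k B (L l) := ⟨fun c a x => by rw [Algebra.smul_def, mul_smul]; rfl⟩
    have := fin (L l)
    obtain ⟨e⟩ := (hform l).equiv
    obtain ⟨-, f, hf, hs⟩ := hP l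
    exact finrank_hom_superfluous hf hs e (hend l)
  · intro l m hlm
    let : Module k (L m) := Module.compHom (L m) (algebraMap k B)
    have : IsScalarTower k B (L m) := ⟨fun c a x => by rw [Algebra.smul_def, mul_smul]; rfl⟩
    have := fin (L m)
    obtain ⟨e⟩ := (hform m).equiv
    have : IsSimpleModule B (ι.TwistedDual (L m)) := IsSimpleModule.congr e.symm
    obtain ⟨-, f, hf, hs⟩ := hP l
    exact finrank_hom_superfluous_eq_zero hf hs fun ⟨e'⟩ =>
      hlm (hL.irredundant l m ⟨e'.trans e.symm⟩)

end AntiInvolution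

/-! ### Cellular algebras -/

/-- For a maximal left ideal `m`, the element `a` kills the class of `1` in the simple module `A /
m`, so `a ∈ m`. -/
theorem mem_jacobson_of_smul_eq_zero {A : Type u} [Ring A] {a : A}
    (h : ∀ (S : Type u) [AddCommGroup S] [Module A S], IsSimpleModule A S → ∀ x : S, a • x = 0) :
    a ∈ Ring.jacobson A := by
  rw [Ring.jacobson, Module.jacobson, Submodule.mem_sInf]
  intro m hm
  have := h (A ⧸ m) (isSimpleModule_iff_isCoatom.2 hm) (Submodule.Quotient.mk 1)
  rwa [← Submodule.Quotient.mk_smul, smul_eq_mul, mul_one, Submodule.Quotient.mk_eq_zero] at this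

theorem smul_eq_zero_of_mem_jacobson {A S : Type*} [Ring A] {a : A} (ha : a ∈ Ring.jacobson A)
    [AddCommGroup S] [Module A S] [IsSemisimpleModule A S] (x : S) : a • x = 0 :=
  Module.mem_annihilator.1 (IsSemisimpleModule.jacobson_le_annihilator A S ha) x

namespace CellDatum

variable {k A : Type*} [Field k] [Ring A] [Algebra k A] (c : CellDatum k A)

instance : PartialOrder c.Cell := c.order
instance : Finite c.Cell := c.finCell
instance (l : c.Cell) : Fintype (c.Idx l) := c.finIdx l

theorem moduleFinite (c : CellDatum k A) : Module.Finite k A := Module.Finite.of_basis c.C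

/-- The anti-involution of a cellular algebra. -/
def antiInvolution : AntiInvolution k A where
  map := c.inv
  map_mul := c.inv_mul
  map_map := c.inv_inv

/-- The span of the basis elements with upper index less than `l`. -/
def lower (l : c.Cell) : Submodule k A :=
  Submodule.span k {x : A | ∃ (m : c.Cell) (U V : c.Idx m), m < l ∧ x = c.C ⟨m, U, V⟩}

theorem repr_eq_zero_of_mem_lower {l : c.Cell} {x : A} (hx : x ∈ c.lower l) (S T : c.Idx l) :
    c.C.repr x ⟨l, S, T⟩ = 0 := by
  classical
  induction hx using Submodule.span_induction with
  | mem x h =>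
    obtain ⟨m, U, V, hm, rfl⟩ := h
    rw [Module.Basis.repr_self, Finsupp.single_apply, if_neg]
    intro h
    exact hm.ne (congrArg Sigma.fst h)
  | zero => simp
  | add x y _ _ hx hy => simp [hx, hy]
  | smul a x _ hx => simp [hx]

theorem inv_mem_lower {l : c.Cell} {x : A} (hx : x ∈ c.lower l) : c.inv x ∈ c.lower l := by
  induction hx using Submodule.span_induction with
  | mem x h =>
    obtain ⟨m, U, V, hm, rfl⟩ := h
    exact Submodule.subset_span ⟨m, V, U, hm, c.inv_basis m U V⟩
  | zero => rw [map_zero]; exact zero_mem _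
  | add x y _ _ hx hy => rw [map_add]; exact add_mem hx hy
  | smul a x _ hx => rw [map_smul]; exact Submodule.smul_mem _ _ hx

/-- The right-handed version of the multiplication rule. -/
theorem mul_basis_right (l : c.Cell) (a : A) (r : c.Idx l → c.Idx l → k)
    (hr : ∀ S T : c.Idx l, a * c.C ⟨l, S, T⟩ - ∑ U, r U S • c.C ⟨l, U, T⟩ ∈ c.lower l)
    (S T : c.Idx l) :
    c.C ⟨l, T, S⟩ * c.inv a - ∑ U, r U S • c.C ⟨l, T, U⟩ ∈ c.lower l := by
  have h := c.inv_mem_lower (hr S T)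
  rw [map_sub, c.inv_mul, c.inv_basis, map_sum] at h
  simpa only [map_smul, c.inv_basis] using h

/-- The bilinear form of a cell. -/
theorem exists_form (l : c.Cell) : ∃ φ : c.Idx l → c.Idx l → k, (∀ T S, φ T S = φ S T) ∧
    ∀ S' T' S T : c.Idx l,
      c.C ⟨l, S', T'⟩ * c.C ⟨l, S, T⟩ - φ T' S • c.C ⟨l, S', T⟩ ∈ c.lower l := by
  classical
  choose r hr using c.mul_basis l
  -- The product `C(S', T') * C(S, T)` is expanded by the left rule and by the right rule. The first
  -- has second index `T`, the second has first index `S'`; comparing the coefficients at `(V, T)`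
  -- leaves only `V = S'`.
  have key : ∀ S' T' S T V : c.Idx l, r (c.C ⟨l, S', T'⟩) V S =
      if V = S' then r (c.C ⟨l, T, S⟩) T T' else 0 := by
    intro S' T' S T V
    have h1 := hr (c.C ⟨l, S', T'⟩) S T
    have h2 := c.mul_basis_right l _ _ (hr (c.C ⟨l, T, S⟩)) T' S'
    rw [c.inv_basis] at h2
    have h3 := c.repr_eq_zero_of_mem_lower (sub_mem h2 h1) V T
    rw [sub_sub_sub_cancel_left, map_sub, Finsupp.sub_apply, sub_eq_zero] at h3
    simpa [Finsupp.single_apply, Finset.sum_apply', eq_comm, Prod.ext_iff, ite_and] using h3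
  refine ⟨fun T S => r (c.C ⟨l, T, T⟩) T S, fun T S => ?_, fun S' T' S T => ?_⟩
  · simpa using key T T S S T
  · have h : _ ∈ c.lower l := hr (c.C ⟨l, S', T'⟩) S T
    have e1 : ∀ V, r (c.C ⟨l, S', T'⟩) V S = if V = S' then r (c.C ⟨l, T', T'⟩) T' S else 0 := by
      intro V
      have := key T' T' S S T'
      rw [if_pos rfl] at this
      rw [key S' T' S S V, this]
    simpa only [e1, ite_smul, zero_smul, Finset.sum_ite_eq', Finset.sum_ite_eq, Finset.mem_univ,
      if_true] using h

section Simple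

variable (L : Type*) [AddCommGroup L] [Module A L]

theorem smul_eq_zero_of_mem_lower [Module k L] [IsScalarTower k A L] {l : c.Cell}
    (h : ∀ m < l, ∀ (S T : c.Idx m) (x : L), c.C ⟨m, S, T⟩ • x = 0) {a : A} (ha : a ∈ c.lower l)
    (x : L) : a • x = 0 := by
  induction ha using Submodule.span_induction with
  | mem a h' =>
    obtain ⟨m, U, V, hm, rfl⟩ := h'
    exact h m hm U V x
  | zero => exact zero_smul _ _
  | add a b _ _ ha hb => rw [add_smul, ha, hb, add_zero]
  | smul t a _ ha => rw [smul_assoc, ha, smul_zero]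

/-- The unit is a combination of cellular basis elements, so some cell acts nontrivially. For a
minimal such cell the multiplication rules, valid modulo lower cells, become exact identities on
`L`. -/
theorem exists_minimal_cell [Module k L] [IsScalarTower k A L] [Nontrivial L] :
    ∃ l : c.Cell, (∃ (S T : c.Idx l) (x : L), c.C ⟨l, S, T⟩ • x ≠ 0) ∧
      ∀ a ∈ c.lower l, ∀ x : L, a • x = 0 := by
  have hne : ∃ l : c.Cell, ∃ (S T : c.Idx l) (x : L), c.C ⟨l, S, T⟩ • x ≠ 0 := by
    by_contra! hall
    obtain ⟨x, hx⟩ := exists_ne (0 : L)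
    have : ∀ a : A, a • x = 0 := fun a => by
      have h : a ∈ Submodule.span k (Set.range c.C) := by rw [c.C.span_eq]; trivial
      induction h using Submodule.span_induction with
      | mem a h' =>
        obtain ⟨⟨m, U, V⟩, rfl⟩ := h'
        exact hall m U V x
      | zero => exact zero_smul _ _
      | add a b _ _ ha hb => rw [add_smul, ha, hb, add_zero]
      | smul t a _ ha => rw [smul_assoc, ha, smul_zero]
    exact hx (by rw [← this 1, one_smul])
  obtain ⟨l, hl, hmin⟩ := exists_minimal_of_wellFoundedLT
    (fun l : c.Cell => ∃ (S T : c.Idx l) (x : L), c.C ⟨l, S, T⟩ • x ≠ 0) hne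
  refine ⟨l, hl, fun a ha x => c.smul_eq_zero_of_mem_lower L (fun m hm S T x => ?_) ha x⟩
  by_contra hx
  exact hm.not_ge (hmin ⟨S, T, x, hx⟩ hm.le)

/-- Simple modules of a cellular algebra have a nonzero invariant form and only scalar
endomorphisms. -/
theorem hasInvariantForm_and_end [IsSimpleModule A L] :
    c.antiInvolution.HasInvariantForm L ∧
      ∀ f : L →ₗ[A] L, ∃ t : k, ∀ x, f x = algebraMap k A t • x := by
  classical
  let : Module k L := Module.compHom L (algebraMap k A)
  have : IsScalarTower k A L := ⟨fun t a x => by rw [Algebra.smul_def, mul_smul]; rfl⟩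
  have := IsSimpleModule.nontrivial A L
  obtain ⟨l, ⟨S₁, T₀, x₀, hx₀⟩, hlow⟩ := c.exists_minimal_cell (k := k) L
  obtain ⟨φ, hφ, hmul⟩ := c.exists_form l
  choose r hr using c.mul_basis l
  have Hr : ∀ (a : A) (S T : c.Idx l) (x : L),
      a • c.C ⟨l, S, T⟩ • x = ∑ U, r a U S • c.C ⟨l, U, T⟩ • x := by
    intro a S T x
    have h := hlow _ (hr a S T) x
    rw [sub_smul, sub_eq_zero, mul_smul, Finset.sum_smul] at h
    simpa only [smul_assoc] using h
  have Hφ : ∀ (S' T' S T : c.Idx l) (x : L),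
      c.C ⟨l, S', T'⟩ • c.C ⟨l, S, T⟩ • x = φ T' S • c.C ⟨l, S', T⟩ • x := by
    intro S' T' S T x
    have h := hlow _ (hmul S' T' S T) x
    rwa [sub_smul, sub_eq_zero, mul_smul, smul_assoc] at h
  -- The map `S ↦ C(S, T₀) • x₀` presents `L` as a quotient of the cell module of `l`: the span of
  -- the `v S` is a nonzero submodule.
  let v : c.Idx l → L := fun S => c.C ⟨l, S, T₀⟩ • x₀
  let p : (c.Idx l → k) →ₗ[k] L := Fintype.linearCombination k v
  have hp : ∀ d, p d = ∑ S, d S • v S := Fintype.linearCombination_apply k v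
  have hspan : Submodule.span k (Set.range v) = ⊤ := by
    let N : Submodule A L :=
      { toAddSubmonoid := (Submodule.span k (Set.range v)).toAddSubmonoid
        smul_mem' := fun a x hx => by
          change x ∈ Submodule.span k (Set.range v) at hx
          change a • x ∈ Submodule.span k (Set.range v)
          induction hx using Submodule.span_induction with
          | mem x h =>
            obtain ⟨S, rfl⟩ := h
            rw [Hr]
            exact sum_mem fun U _ => Submodule.smul_mem _ _ (Submodule.subset_span ⟨U, rfl⟩)
          | zero => rw [smul_zero]; exact zero_mem _
          | add x y _ _ hx hy => rw [smul_add]; exact add_mem hx hy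
          | smul t x _ hx => rw [smul_algebra_smul_comm]; exact Submodule.smul_mem _ _ hx }
    have hN : N = ⊤ := (eq_bot_or_eq_top N).resolve_left fun hN => hx₀ (by
      have : v S₁ ∈ N := Submodule.subset_span (Set.mem_range_self S₁)
      rwa [hN] at this)
    refine eq_top_iff.2 fun x _ => ?_
    have hx : x ∈ N := by rw [hN]; trivial
    exact hx
  obtain ⟨σ, hσ⟩ := p.exists_rightInverse_of_surjective
    ((Fintype.range_linearCombination k v).trans hspan)
  have hσ' : ∀ y, ∑ S, σ y S • v S = y := fun y => by
    rw [← hp]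
    exact LinearMap.congr_fun hσ y
  -- The coefficient in `C(S, T) • y = f T y • v S`. It is written through the chosen coordinates
  -- `σ`, but `v S₁ ≠ 0` determines it.
  let f : c.Idx l → L → k := fun T y => ∑ S, φ T S * σ y S
  have Hf : ∀ (S T : c.Idx l) (y : L), c.C ⟨l, S, T⟩ • y = f T y • v S := by
    intro S T y
    conv_lhs => rw [← hσ' y]
    simp only [f, Finset.smul_sum, Finset.sum_smul]
    refine Finset.sum_congr rfl fun U _ => ?_
    rw [smul_algebra_smul_comm, Hφ, smul_smul, mul_comm]
  have funique : ∀ {s t : k}, s • v S₁ = t • v S₁ → s = t := fun h => smul_left_injective k hx₀ h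
  have fadd : ∀ T y z, f T (y + z) = f T y + f T z := fun T y z => by
    simp only [f, map_add, Pi.add_apply, mul_add, Finset.sum_add_distrib]
  have fsmul : ∀ T (t : k) y, f T (t • y) = t * f T y := fun T t y => by
    simp only [f, map_smul, Pi.smul_apply, smul_eq_mul, Finset.mul_sum]
    exact Finset.sum_congr rfl fun _ _ => by ring
  have fv : ∀ T S, f T (v S) = φ T S := fun T S => funique (by rw [← Hf, Hφ])
  have fx₀ : f T₀ x₀ = 1 := funique (by rw [← Hf, one_smul])
  -- The cell form `φ` transported to `L` in the coordinates `σ`. It satisfies `θ (v T) y = f T y`,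
  -- which makes it nonzero and reduces invariance to the multiplication rules.
  let θ : L → L → k := fun x y => ∑ T, σ x T * f T y
  have θsymm : ∀ x y, θ x y = θ y x := fun x y => by
    simp only [θ, f, Finset.mul_sum]
    rw [Finset.sum_comm]
    refine Finset.sum_congr rfl fun T _ => Finset.sum_congr rfl fun S _ => ?_
    rw [hφ]; ring
  have θadd : ∀ x y z, θ x (y + z) = θ x y + θ x z := fun x y z => by
    simp only [θ, fadd, mul_add, Finset.sum_add_distrib]
  have θsmul : ∀ (t : k) x y, θ x (t • y) = t * θ x y := fun t x y => by
    simp only [θ, fsmul, Finset.mul_sum]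
    exact Finset.sum_congr rfl fun _ _ => by ring
  have θv : ∀ T y, θ (v T) y = f T y := fun T y => by
    rw [θsymm]
    simp only [θ, f, fv]
    exact Finset.sum_congr rfl fun S _ => by rw [hφ]; ring
  have θadd' : ∀ x y z, θ (x + y) z = θ x z + θ y z := fun x y z => by
    rw [θsymm, θadd, θsymm z x, θsymm z y]
  have θsmul' : ∀ (t : k) x y, θ (t • x) y = t * θ x y := fun t x y => by
    rw [θsymm, θsmul, θsymm]
  have ext : ∀ x : L, x ∈ Submodule.span k (Set.range v) := fun x => by rw [hspan]; trivial
  refine ⟨⟨AddMonoidHom.mk' (fun x => AddMonoidHom.mk' (θ x) (θadd x))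
    fun x y => by ext z; exact θadd' x y z, ?_, ?_, fun t x y => θsmul t x y⟩, fun g => ?_⟩
  · intro h0
    have h1 : θ (v T₀) x₀ = 0 := DFunLike.congr_fun (DFunLike.congr_fun h0 (v T₀)) x₀
    rw [θv, fx₀] at h1
    exact one_ne_zero h1
  · intro a x y
    change θ (a • x) y = θ x (c.inv a • y)
    induction ext x using Submodule.span_induction with
    | mem x h =>
      obtain ⟨T, rfl⟩ := h
      have h1 : θ (a • v T) y = ∑ U, r a U T * f U y := by
        have : ∀ s : Finset (c.Idx l), θ (∑ U ∈ s, r a U T • v U) y = ∑ U ∈ s, r a U T * f U y := by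
          intro s
          induction s using Finset.induction_on with
          | empty => simpa using θsmul' 0 0 y
          | insert U s hU ih => rw [Finset.sum_insert hU, θadd', θsmul', θv, ih, Finset.sum_insert hU]
        rw [Hr]
        exact this _
      rw [h1, θv]
      -- The right-handed rule for `C(S₁, T) * inv a`, applied to `y`, gives the same sum as the
      -- left-handed rule for `a • v T`, as a multiple of `v S₁`.
      have h2 := hlow _ (c.mul_basis_right l a (r a) (hr a) T S₁) y
      rw [sub_smul, sub_eq_zero, mul_smul, Hf] at h2
      apply funique
      rw [h2, Finset.sum_smul, Finset.sum_smul]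
      refine Finset.sum_congr rfl fun U _ => ?_
      rw [smul_assoc, Hf, smul_smul]
    | zero =>
      rw [smul_zero]
      have := θsmul' 0 0
      simp only [zero_smul, zero_mul] at this
      rw [this, this]
    | add x z _ _ hx hz => rw [smul_add, θadd', θadd', hx, hz]
    | smul t x _ hx => rw [smul_algebra_smul_comm, θsmul', θsmul', hx]
  -- Since `v S = C(S, T₀) • x₀`, an endomorphism `g` sends it to `C(S, T₀) • g x₀ = f T₀ (g x₀) • v
  -- S`.
  · refine ⟨f T₀ (g x₀), fun x => ?_⟩
    change g x = f T₀ (g x₀) • x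
    induction ext x using Submodule.span_induction with
    | mem x h =>
      obtain ⟨S, rfl⟩ := h
      rw [map_smul, Hf]
    | zero => rw [map_zero, smul_zero]
    | add x z _ _ hx hz => rw [map_add, smul_add, hx, hz]
    | smul t x _ hx => rw [g.map_smul_of_tower, hx, smul_comm]

end Simple

end CellDatum

theorem AntiInvolution.map_mem_radSeries {k : Type*} {A : Type u} [Field k] [Ring A] [Algebra k A]
    [IsArtinianRing A] (ι : AntiInvolution k A)
    (h : ∀ a ∈ Ring.jacobson A, ι.map a ∈ Ring.jacobson A) (n : ℕ) {a : A}
    (ha : a ∈ (radSeries A A n : Ideal A)) : ι.map a ∈ (radSeries A A n : Ideal A) := by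
  induction n generalizing a with
  | zero => exact Submodule.mem_top
  | succ n ih =>
    rw [radSeries_succ] at ha
    refine Submodule.smul_induction_on ha (fun b hb x hx => ?_) fun x y hx hy => ?_
    · rw [smul_eq_mul, ι.map_mul]
      exact mul_mem_radSeries_self (ih hx) (h b hb)
    · rw [map_add]
      exact add_mem hx hy

theorem AntiInvolution.HasInvariantForm.of_quotient {k A B : Type*} [Field k] [Ring A]
    [Algebra k A] [Ring B] [Algebra k B] {ι : AntiInvolution k A} {ι' : AntiInvolution k B}
    {σ : A →ₐ[k] B} (hσ : Function.Surjective σ) (hι : ∀ a, ι'.map (σ a) = σ (ι.map a))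
    {L : Type*} [AddCommGroup L] [Module A L] [Module B L] (hL : ∀ (a : A) (x : L), σ a • x = a • x)
    (h : ι.HasInvariantForm L) : ι'.HasInvariantForm L := by
  obtain ⟨θ, h0, h1, h2⟩ := h
  refine ⟨θ, h0, fun b x y => ?_, fun t x y => ?_⟩
  · obtain ⟨a, rfl⟩ := hσ b
    rw [hι, hL, hL, h1]
  · rw [← h2, ← hL, AlgHom.commutes]

/-- The Jacobson radical is the common annihilator of the simple modules, and each of these
annihilators is stable under the anti-involution. So the anti-involution descends to the quotient,
and the invariant forms remain invariant. -/
theorem algCartanMatrix_isSymm_of_isCellular {k : Type*} {A : Type u} [Field k] [Ring A]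
    [Algebra k A] {Λ : Type*} {L P : Λ → Type u} [∀ l, AddCommGroup (L l)] [∀ l, Module A (L l)]
    [∀ l, AddCommGroup (P l)] {s : ℕ} [∀ l, Module (RadQuotient A s) (L l)]
    [∀ l, Module (RadQuotient A s) (P l)]
    (hL : ∀ (l : Λ) (a : A) (x : L l), Ideal.Quotient.mk (radSeries A A s : Ideal A) a • x = a • x)
    (hA : IsCellularAlgebra k A) (simples : IsCompleteListOfSimples A L)
    (simples' : IsCompleteListOfSimples (RadQuotient A s) L)
    (cover : ∀ l, IsProjectiveCover (RadQuotient A s) (P l) (L l)) :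
    (algCartanMatrix (RadQuotient A s) P L).IsSymm := by
  obtain ⟨c⟩ := hA
  have := simples.simple
  have := c.moduleFinite
  have : IsArtinianRing A := IsArtinianRing.of_finite k A
  let σ : A →ₐ[k] RadQuotient A s := Ideal.Quotient.mkₐ k (radSeries A A s : Ideal A)
  have hσ : Function.Surjective σ := Ideal.Quotient.mk_surjective
  have hJ : ∀ a ∈ Ring.jacobson A, c.antiInvolution.map a ∈ Ring.jacobson A := fun a ha =>
    mem_jacobson_of_smul_eq_zero fun S _ _ hS =>
      (c.hasInvariantForm_and_end S).1.smul_eq_zero _ fun x => smul_eq_zero_of_mem_jacobson ha x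
  obtain ⟨ι, hι⟩ := c.antiInvolution.exists_quotient σ hσ fun a ha =>
    Ideal.Quotient.eq_zero_iff_mem.2
      (c.antiInvolution.map_mem_radSeries hJ s (Ideal.Quotient.eq_zero_iff_mem.1 ha))
  have : Module.Finite k (RadQuotient A s) := Module.Finite.of_surjective σ.toLinearMap hσ
  refine ι.algCartanMatrix_isSymm simples' cover (fun l f => ?_) fun l =>
    (c.hasInvariantForm_and_end (L l)).1.of_quotient hσ hι (hL l)
  obtain ⟨t, ht⟩ := (c.hasInvariantForm_and_end (L l)).2 (f.ofQuotientRing (hL l) (hL l))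
  refine ⟨t, fun x => ?_⟩
  rw [← AlgHom.commutes σ]
  exact (ht x).trans (hL l _ x).symm

/-! ### Dualities -/

theorem exists_lift_of_isTorsionBySet {A : Type*} [Ring A] {I : Ideal A} [I.IsTwoSided]
    {P U V : Type*} [AddCommGroup P] [Module A P] [Module (A ⧸ I) P] [Module.Projective (A ⧸ I) P]
    (hP : ∀ (a : A) (x : P), Ideal.Quotient.mk I a • x = a • x)
    [AddCommGroup U] [Module A U] (hU : Module.IsTorsionBySet A U I)
    [AddCommGroup V] [Module A V] (hV : Module.IsTorsionBySet A V I)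
    {q : U →ₗ[A] V} (hq : Function.Surjective q) (t : P →ₗ[A] V) : ∃ t' : P →ₗ[A] U, q ∘ₗ t' = t := by
  let := hU.module
  let := hV.module
  have hσ : Function.Surjective (Ideal.Quotient.mk I) := Ideal.Quotient.mk_surjective
  obtain ⟨t', ht'⟩ := Module.projective_lifting_property
    (q.toQuotientRing hσ hU.mk_smul hV.mk_smul) (t.toQuotientRing hσ hP hV.mk_smul) hq
  exact ⟨t'.ofQuotientRing hP hU.mk_smul, LinearMap.ext fun x => LinearMap.congr_fun ht' x⟩

theorem superfluous_restrict {A B : Type*} [Ring A] [Ring B] {σ : A →+* B}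
    (hσ : Function.Surjective σ) {M N : Type*}
    [AddCommGroup M] [Module A M] [Module B M] [AddCommGroup N] [Module A N] [Module B N]
    (hM : ∀ (a : A) (x : M), σ a • x = a • x) {g : M →ₗ[B] N}
    (hs : ∀ K : Submodule B M, K ⊔ LinearMap.ker g = ⊤ → K = ⊤)
    {f : M →ₗ[A] N} (hg : ∀ x, g x = f x)
    (K : Submodule A M) (hK : K ⊔ LinearMap.ker f = ⊤) : K = ⊤ := by
  let K' : Submodule B M :=
    { toAddSubmonoid := K.toAddSubmonoid
      smul_mem' := fun b x hx => by
        obtain ⟨a, rfl⟩ := hσ b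
        rw [hM]
        exact K.smul_mem a hx }
  have key : K' = ⊤ := by
    apply hs
    rw [eq_top_iff]
    intro x _
    have hx : x ∈ K ⊔ LinearMap.ker f := by rw [hK]; exact Submodule.mem_top
    obtain ⟨y, hy, z, hz, hyz⟩ := Submodule.mem_sup.1 hx
    rw [LinearMap.mem_ker, ← hg] at hz
    have hy' : y ∈ K' := hy
    rw [← hyz]
    exact Submodule.add_mem_sup hy' (LinearMap.mem_ker.2 hz)
  refine eq_top_iff.2 fun x _ => ?_
  have hx : x ∈ K' := by rw [key]; exact Submodule.mem_top
  exact hx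

namespace FGModuleCat

open Opposite

variable {k : Type*} {A : Type u} [Field k] [Ring A] [Algebra k A]

/-- A linear map as a morphism. -/
abbrev homOf {X Y : FGModuleCat.{u} A} (f : X →ₗ[A] Y) : X ⟶ Y := FGModuleCat.ofHom f

local instance moduleField (X : FGModuleCat.{u} A) : Module k X := Module.compHom X (algebraMap k A)

local instance isScalarTowerField (X : FGModuleCat.{u} A) : IsScalarTower k A X :=
  ⟨fun c a x => by rw [Algebra.smul_def, mul_smul]; rfl⟩

variable {δ : (FGModuleCat.{u} A)ᵒᵖ ⥤ FGModuleCat.{u} A}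

/-- For a submodule `i : Y → δ X`, the epimorphism `δ i` starts at `δ δ X ≅ X`, which is semisimple,
so it splits. Applying `δ` to the section and transporting along `δ δ ≅ id` gives a retraction of
`i`. -/
theorem _root_.IsDuality.isSemisimpleModule (hδ : IsDuality k A δ) [IsNoetherianRing A] (X : FGModuleCat.{u} A)
    [IsSemisimpleModule A X] : IsSemisimpleModule A (δ.obj (op X)) := by
  obtain ⟨η⟩ := hδ.involutive
  refine (isSemisimpleModule_iff A _).2 ⟨fun Y => ?_⟩
  let i : FGModuleCat.of A Y ⟶ δ.obj (op X) := homOf Y.subtype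
  let q : δ.obj (op X) ⟶ FGModuleCat.of A (δ.obj (op X) ⧸ Y) := homOf Y.mkQ
  have hsurj := (hδ.exact _ _ _ i q Y.subtype_injective
    (LinearMap.exact_subtype_mkQ Y) Y.mkQ_surjective).2.2
  have : IsSemisimpleModule A ((𝟭 (FGModuleCat.{u} A)).obj X) := ‹IsSemisimpleModule A X›
  have : IsSemisimpleModule A (δ.obj (op (δ.obj (op X)))) :=
    .congr (FGModuleCat.isoToLinearEquiv (η.app X))
  obtain ⟨t, ht⟩ := IsSemisimpleModule.lifting_property _ hsurj LinearMap.id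
  have ht' : homOf t ≫ δ.map i.op = 𝟙 _ := FGModuleCat.hom_ext ht
  have h1 : δ.map (δ.map i.op).op ≫ δ.map (homOf t).op = 𝟙 _ := by
    rw [← δ.map_comp, ← op_comp, ht', op_id, δ.map_id]
  let r : δ.obj (op X) ⟶ FGModuleCat.of A Y := η.inv.app _ ≫ δ.map (homOf t).op ≫ η.hom.app _
  have hr : i ≫ r = 𝟙 _ := by
    have h3 := η.inv.naturality i
    change i ≫ η.inv.app _ = η.inv.app _ ≫ δ.map (δ.map i.op).op at h3
    rw [← Category.assoc, h3, Category.assoc, ← Category.assoc (δ.map (δ.map i.op).op), h1,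
      Category.id_comp]
    exact η.inv_hom_id_app _
  exact ⟨_, LinearMap.isCompl_of_proj (f := r.hom.hom) fun x =>
    LinearMap.congr_fun (congrArg (fun z => z.hom.hom) hr) x⟩

/-- Apply `δ` to `0 → J X → X → X / J X → 0`, where `J` is the Jacobson radical. If `rad^(n+1) A`
kills `X`, then `rad^n A` kills `J X`, hence `δ (J X)` by induction. As `δ (X / J X)` is semisimple,
it is killed by `J`, and so `J · rad^n A` kills `δ X`. -/
theorem _root_.IsDuality.isTorsionBySet_radSeries (hδ : IsDuality k A δ) [IsArtinianRing A] (n : ℕ)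
    (X : FGModuleCat.{u} A) (hX : Module.IsTorsionBySet A X (radSeries A A n : Ideal A)) :
    Module.IsTorsionBySet A (δ.obj (op X)) (radSeries A A n : Ideal A) := by
  induction n generalizing X with
  | zero =>
    -- Here `rad^0 A = A`, so `X = 0` and its identity is `0` times itself; linearity of `δ` carries
    -- this to `δ X`.
    have h0 : ∀ x : X, x = 0 := fun x => by
      rw [← one_smul A x]
      exact @hX x ⟨1, Submodule.mem_top⟩
    have h := hδ.smul X X (𝟙 X) (𝟙 X) 0 fun x => (h0 _).trans (h0 _).symm
    rw [op_id, δ.map_id] at h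
    rintro y ⟨a, -⟩
    have hy : y = algebraMap k A 0 • y := h y
    rw [map_zero, zero_smul] at hy
    change a • y = 0
    rw [hy, smul_zero]
  | succ n ih =>
    let N : Submodule A X := Ring.jacobson A • ⊤
    have hN : Module.IsTorsionBySet A N (radSeries A A n : Ideal A) := by
      rintro ⟨x, hx⟩ ⟨a, ha⟩
      refine Subtype.ext ?_
      change a • x = 0
      refine Submodule.smul_induction_on hx (fun b hb y _ => ?_) fun y z hy hz => ?_
      · rw [← mul_smul]
        exact @hX y ⟨a * b, mul_mem_radSeries_self ha hb⟩
      · rw [smul_add, hy, hz, add_zero]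
    have hDN := ih (FGModuleCat.of A N) hN
    have hss : IsSemisimpleModule A (FGModuleCat.of A (X ⧸ N)) :=
      isSemisimpleModule_quotient_jacobson_smul_top A X
    have hDQ := hδ.isSemisimpleModule (FGModuleCat.of A (X ⧸ N))
    let i : FGModuleCat.of A N ⟶ X := homOf N.subtype
    let q : X ⟶ FGModuleCat.of A (X ⧸ N) := homOf N.mkQ
    have hex := (hδ.exact _ _ _ i q N.subtype_injective
      (LinearMap.exact_subtype_mkQ N) N.mkQ_surjective).2.1
    rintro x ⟨a, ha⟩
    change a • x = 0
    have ha' : a ∈ radSeries A A (n + 1) := ha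
    rw [radSeries_succ] at ha'
    refine Submodule.smul_induction_on ha' (fun b hb c hc => ?_) fun b c hb hc => ?_
    · obtain ⟨y, hy⟩ := (hex (c • x)).1 (by
        rw [map_smul]
        exact @hDN ((δ.map i.op).hom.hom x) ⟨c, hc⟩)
      rw [smul_eq_mul, mul_smul, ← hy, ← map_smul, smul_eq_zero_of_mem_jacobson hb, map_zero]
    · rw [add_smul, hb, hc, add_zero]

/-- A map `t : X → δ Y` goes to `Y ≅ δ δ Y → δ X`. This is linear, and injective because `δ δ ≅ id`
is faithful; exchanging `X` and `Y` gives the reverse inequality. -/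
theorem _root_.IsDuality.finrank_hom_le (hδ : IsDuality k A δ) [Module.Finite k A]
    (X Y : FGModuleCat.{u} A) :
    Module.finrank k (X →ₗ[A] δ.obj (op Y)) ≤ Module.finrank k (Y →ₗ[A] δ.obj (op X)) := by
  obtain ⟨η⟩ := hδ.involutive
  have := hδ.additive
  have : Module.Finite k (δ.obj (op X)) := Module.Finite.trans A _
  have := finite_linearMap (k := k) (B := A) Y (δ.obj (op X))
  let T : (X →ₗ[A] δ.obj (op Y)) →ₗ[k] (Y →ₗ[A] δ.obj (op X)) :=
    { toFun := fun t => (η.inv.app Y ≫ δ.map (homOf t).op).hom.hom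
      map_add' := fun t t' => by
        have : (homOf (t + t')).op = (homOf t).op + (homOf t').op := rfl
        rw [this, δ.map_add, Preadditive.comp_add]
        rfl
      map_smul' := fun c t => by
        ext y
        exact hδ.smul _ _ (homOf t) (homOf (c • t)) c (fun _ => rfl) _ }
  refine LinearMap.finrank_le_finrank_of_injective (f := T) fun t t' h => ?_
  have h1 : η.inv.app Y ≫ δ.map (homOf t).op = η.inv.app Y ≫ δ.map (homOf t').op :=
    FGModuleCat.hom_ext h
  rw [cancel_epi] at h1
  have h2 : δ.map (δ.map (homOf t).op).op = δ.map (δ.map (homOf t').op).op := by rw [h1]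
  have h3 := η.hom.naturality (homOf t)
  have h4 := η.hom.naturality (homOf t')
  change δ.map (δ.map (homOf t).op).op ≫ _ = _ ≫ homOf t at h3
  change δ.map (δ.map (homOf t').op).op ≫ _ = _ ≫ homOf t' at h4
  rw [h2, h4, cancel_epi] at h3
  exact congrArg (fun z => z.hom.hom) h3.symm

theorem _root_.IsDuality.finrank_hom_comm (hδ : IsDuality k A δ) [Module.Finite k A]
    (X Y : FGModuleCat.{u} A) :
    Module.finrank k (X →ₗ[A] δ.obj (op Y)) = Module.finrank k (Y →ₗ[A] δ.obj (op X)) :=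
  le_antisymm (hδ.finrank_hom_le X Y) (hδ.finrank_hom_le Y X)

/-- A module over a quotient of `A`, as an `A`-module. -/
def restrict {B : Type u} [Ring B] (σ : A →+* B) (hσ : Function.Surjective σ)
    (M : Type u) [AddCommGroup M] [Module B M] (hM : Module.Finite B M) : FGModuleCat.{u} A :=
  ⟨@ModuleCat.of A _ M _ (Module.compHom M σ), by
    let : Module A M := Module.compHom M σ
    obtain ⟨s, hs⟩ := hM
    refine ⟨⟨s, eq_top_iff.2 fun x _ => ?_⟩⟩
    have hx : x ∈ Submodule.span B (s : Set M) := by rw [hs]; exact Submodule.mem_top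
    induction hx using Submodule.span_induction with
    | mem x h => exact Submodule.subset_span h
    | zero => exact zero_mem _
    | add x y _ _ hx hy => exact add_mem (hx trivial) (hy trivial)
    | smul b x _ hx =>
      obtain ⟨a, rfl⟩ := hσ b
      exact Submodule.smul_mem _ a (hx trivial)⟩

section Restrict

variable {B : Type u} [Ring B] (σ : A →+* B) (hσ : Function.Surjective σ)
  (M : Type u) [AddCommGroup M] [Module B M] (hM : Module.Finite B M)

instance : Module B (restrict σ hσ M hM) := inferInstanceAs (Module B M)

theorem restrict_smul (a : A) (x : restrict σ hσ M hM) : σ a • x = a • x := rfl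

end Restrict

theorem isTorsionBySet_restrict {I : Ideal A} [I.IsTwoSided]
    (M : Type u) [AddCommGroup M] [Module (A ⧸ I) M] (hM : Module.Finite (A ⧸ I) M) :
    Module.IsTorsionBySet A (restrict _ Ideal.Quotient.mk_surjective M hM) I := by
  rintro x ⟨a, ha⟩
  change a • x = 0
  rw [← restrict_smul, Ideal.Quotient.eq_zero_iff_mem.2 ha, zero_smul]

/-- A module over `A` and a quotient of `A`, compared with its restriction. -/
def restrictEquiv {B : Type u} [Ring B] {σ : A →+* B} (hσ : Function.Surjective σ)
    (M : Type u) [AddCommGroup M] [Module A M] [Module B M] (hM : Module.Finite B M)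
    (h : ∀ (a : A) (x : M), σ a • x = a • x) : restrict σ hσ M hM ≃ₗ[A] M where
  toFun x := x
  invFun x := x
  map_add' _ _ := rfl
  map_smul' a x := h a x
  left_inv _ := rfl
  right_inv _ := rfl

/-- The form is `dim Hom_A(M, δ N)` on restrictions of modules over the quotient. As `δ` keeps
modules killed by `rad^s A` among themselves, projectivity over the quotient suffices for the lifts
that give additivity. -/
theorem _root_.algCartanMatrix_isSymm_of_isDuality {k : Type*} {A : Type u} [Field k] [Ring A]
    [Algebra k A] [IsAlgClosed k] [Module.Finite k A]
    {Λ : Type*} {L P : Λ → Type u} [∀ l, AddCommGroup (L l)] [∀ l, Module A (L l)]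
    [∀ l, AddCommGroup (P l)] {s : ℕ} [∀ l, Module (RadQuotient A s) (L l)]
    [∀ l, Module (RadQuotient A s) (P l)]
    (hL : ∀ (l : Λ) (a : A) (x : L l), Ideal.Quotient.mk (radSeries A A s : Ideal A) a • x = a • x)
    {δ : (FGModuleCat.{u} A)ᵒᵖ ⥤ FGModuleCat.{u} A} (hδ : IsDuality k A δ)
    (fix : ∀ (l : Λ) (X : FGModuleCat.{u} A), Nonempty (X ≃ₗ[A] L l) →
        Nonempty (δ.obj (Opposite.op X) ≃ₗ[A] L l))
    (simples : IsCompleteListOfSimples A L)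
    (simples' : IsCompleteListOfSimples (RadQuotient A s) L)
    (cover : ∀ l, IsProjectiveCover (RadQuotient A s) (P l) (L l)) :
    (algCartanMatrix (RadQuotient A s) P L).IsSymm := by
  classical
  have := simples.simple
  have := simples'.simple
  have := fun l => (cover l).finite
  have : IsArtinianRing A := IsArtinianRing.of_finite k A
  let σ : A →+* RadQuotient A s := Ideal.Quotient.mk (radSeries A A s : Ideal A)
  have hσ : Function.Surjective σ := Ideal.Quotient.mk_surjective
  have : IsArtinianRing (RadQuotient A s) := hσ.isArtinianRing
  -- The functor `δ` takes only finitely generated modules; the value `0` elsewhere is never used.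
  let h : ∀ (M N : Type u) [AddCommGroup M] [Module (RadQuotient A s) M]
      [AddCommGroup N] [Module (RadQuotient A s) N], ℕ := fun M N _ _ _ _ =>
    if hMN : Module.Finite (RadQuotient A s) M ∧ Module.Finite (RadQuotient A s) N then
      Module.finrank k (restrict σ hσ M hMN.1 →ₗ[A] δ.obj (op (restrict σ hσ N hMN.2))) else 0
  have h_eq : ∀ (M N : Type u) [AddCommGroup M] [Module (RadQuotient A s) M]
      [AddCommGroup N] [Module (RadQuotient A s) N] (hM : Module.Finite (RadQuotient A s) M)
      (hN : Module.Finite (RadQuotient A s) N), h M N =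
      Module.finrank k (restrict σ hσ M hM →ₗ[A] δ.obj (op (restrict σ hσ N hN))) :=
    fun M N _ _ _ _ hM hN => dif_pos ⟨hM, hN⟩
  refine algCartanMatrix_isSymm_of_form h simples' inferInstance ?_ ?_ ?_ ?_
  · intro M N _ _ _ _ hM hN
    rw [h_eq M N hM hN, h_eq N M hN hM]
    exact hδ.finrank_hom_comm _ _
  · intro l X Y Z _ _ _ _ _ _ hX hY hZ f g hf hfg hg
    have hP := (cover l).finite
    rw [h_eq _ _ hP hX, h_eq _ _ hP hY, h_eq _ _ hP hZ]
    let f' : restrict σ hσ X hX ⟶ restrict σ hσ Y hY :=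
      homOf (f.ofQuotientRing (restrict_smul σ hσ X hX) (restrict_smul σ hσ Y hY))
    let g' : restrict σ hσ Y hY ⟶ restrict σ hσ Z hZ :=
      homOf (g.ofQuotientRing (restrict_smul σ hσ Y hY) (restrict_smul σ hσ Z hZ))
    obtain ⟨h1, h2, h3⟩ := hδ.exact _ _ _ f' g' hf hfg hg
    have : Module.Finite k (δ.obj (op (restrict σ hσ Y hY))) := Module.Finite.trans A _
    have : Module.Projective (RadQuotient A s) (restrict σ hσ (P l) hP) := (cover l).1
    exact (finrank_hom_eq_add _ _ h1 h2 fun t =>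
      exists_lift_of_isTorsionBySet (restrict_smul σ hσ (P l) hP)
        (hδ.isTorsionBySet_radSeries s _ (isTorsionBySet_restrict Y hY))
        (hδ.isTorsionBySet_radSeries s _ (isTorsionBySet_restrict X hX)) h3 t).trans
          (add_comm _ _)
  all_goals
    have key : ∀ l, ∃ f : restrict σ hσ (P l) (cover l).finite →ₗ[A] L l, Function.Surjective f ∧
        ∀ N : Submodule A (restrict σ hσ (P l) (cover l).finite),
          N ⊔ LinearMap.ker f = ⊤ → N = ⊤ := by
      intro l
      obtain ⟨-, f, hf, hs⟩ := cover l
      exact ⟨LinearMap.ofQuotientRing (M := restrict σ hσ (P l) (cover l).finite)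
        (restrict_smul σ hσ _ _) (hL l) f, hf,
        superfluous_restrict hσ (restrict_smul σ hσ _ _) hs fun _ => rfl⟩
    have dual : ∀ l hl, Nonempty (δ.obj (op (restrict σ hσ (L l) hl)) ≃ₗ[A] L l) := fun l hl =>
      fix l _ ⟨restrictEquiv hσ (L l) hl (hL l)⟩
  · intro l
    have hl : Module.Finite (RadQuotient A s) (L l) := inferInstance
    rw [h_eq _ _ (cover l).finite hl]
    obtain ⟨f, hf, hs⟩ := key l
    obtain ⟨e⟩ := dual l hl
    refine finrank_hom_superfluous hf hs e.symm fun g => ?_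
    let : Module k (L l) := Module.compHom (L l) (algebraMap k A)
    have : IsScalarTower k A (L l) := ⟨fun c a x => by rw [Algebra.smul_def, mul_smul]; rfl⟩
    have : Module.Finite k (L l) := Module.Finite.trans A _
    obtain ⟨c, hc⟩ := (IsSimpleModule.algebraMap_end_bijective_of_isAlgClosed (A := A) k).2 g
    exact ⟨c, fun x => (LinearMap.congr_fun hc x).symm⟩
  · intro l m hlm
    have hl : Module.Finite (RadQuotient A s) (L m) := inferInstance
    rw [h_eq _ _ (cover l).finite hl]
    obtain ⟨f, hf, hs⟩ := key l
    obtain ⟨e⟩ := dual m hl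
    have : IsSimpleModule A (δ.obj (op (restrict σ hσ (L m) hl))) := .congr e
    exact finrank_hom_superfluous_eq_zero hf hs fun ⟨e'⟩ =>
      hlm (simples.irredundant l m ⟨e'.trans e⟩)

end FGModuleCat

/-! ### The two cases combined. -/

theorem corollary8 {k : Type*} {A : Type u} [Field k] [Ring A] [Algebra k A]
    {Λ : Type*} (L P : Λ → Type u)
    [∀ l, AddCommGroup (L l)] [∀ l, Module A (L l)]
    [∀ l, AddCommGroup (P l)] [∀ l, Module A (P l)]
    (hL : IsCompleteListOfSimples A L)
    (hP : ∀ l, IsProjectiveCover A (P l) (L l))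
    (hA : IsCellularAlgebra k A ∨ IsBGGAlgebra k A L P)
    (s : ℕ) (hs : 1 ≤ s) :
    Module.Finite k (RadQuotient A s) ∧
    ∃ (_ : ∀ l, Module (RadQuotient A s) (L l))
      (_ : ∀ l, Module (RadQuotient A s) (P l ⧸ radSeries A (P l) s)),
      -- the module structures are the ones induced from `A`
      (∀ (l : Λ) (a : A) (x : L l),
        (Ideal.Quotient.mk (radSeries A A s : Ideal A) a : RadQuotient A s) • x = a • x) ∧
      (∀ (l : Λ) (a : A) (x : P l ⧸ radSeries A (P l) s),
        (Ideal.Quotient.mk (radSeries A A s : Ideal A) a : RadQuotient A s) • x = a • x) ∧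
      -- the `L(l)` are the simple modules
      IsCompleteListOfSimples (RadQuotient A s) L ∧
      -- the `P(l) / rad^s P(l)` are the corresponding principal indecomposable modules
      (∀ l, IsPrincipalIndecomposable (RadQuotient A s) (P l ⧸ radSeries A (P l) s) ∧
        IsProjectiveCover (RadQuotient A s) (P l ⧸ radSeries A (P l) s) (L l)) ∧
      (∀ (Q : Type u) [AddCommGroup Q] [Module (RadQuotient A s) Q],
        IsPrincipalIndecomposable (RadQuotient A s) Q →
          ∃! l, Nonempty (Q ≃ₗ[RadQuotient A s] (P l ⧸ radSeries A (P l) s))) ∧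
      -- the Cartan matrix is symmetric
      (algCartanMatrix (RadQuotient A s) (fun l => P l ⧸ radSeries A (P l) s) L).IsSymm := by
  have := hL.simple
  have hfin : Module.Finite k A := by
    rcases hA with ⟨⟨c⟩⟩ | ⟨⟨_, h⟩, -⟩
    · exact c.moduleFinite
    · exact h.finite
  have h1 : ∀ l, Module.IsTorsionBySet A (L l) (radSeries A A s : Ideal A) := fun l =>
    isTorsionBySet_radSeries_of_simple hs
  have h2 : ∀ l, Module.IsTorsionBySet A (P l ⧸ radSeries A (P l) s)
      (radSeries A A s : Ideal A) := fun l => isTorsionBySet_quotient_radSeries A (P l) s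
  let : ∀ l, Module (RadQuotient A s) (L l) := fun l => (h1 l).module
  let : ∀ l, Module (RadQuotient A s) (P l ⧸ radSeries A (P l) s) := fun l => (h2 l).module
  have hL' : ∀ (l : Λ) (a : A) (x : L l),
      (Ideal.Quotient.mk (radSeries A A s : Ideal A) a : RadQuotient A s) • x = a • x :=
    fun l => (h1 l).mk_smul
  have hP' : ∀ (l : Λ) (a : A) (x : P l ⧸ radSeries A (P l) s),
      (Ideal.Quotient.mk (radSeries A A s : Ideal A) a : RadQuotient A s) • x = a • x :=
    fun l => (h2 l).mk_smul
  have simples : IsCompleteListOfSimples (RadQuotient A s) L :=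
    hL.of_surjective Ideal.Quotient.mk_surjective hL'
  have := simples.simple
  have cover : ∀ l, IsProjectiveCover (RadQuotient A s) (P l ⧸ radSeries A (P l) s) (L l) :=
    fun l => (hP l).radQuotient hs (hL' l) (hP' l)
  refine ⟨Module.Finite.of_surjective
      (Ideal.Quotient.mkₐ k (radSeries A A s : Ideal A)).toLinearMap Ideal.Quotient.mk_surjective,
    inferInstance, inferInstance, hL', hP', simples,
    fun l => ⟨(cover l).isPrincipalIndecomposable, cover l⟩,
    fun Q _ _ hQ => existsUnique_equiv_projectiveCover simples cover hQ, ?_⟩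
  rcases hA with hA | ⟨⟨_, h⟩, δ, hδ, fix⟩
  · exact algCartanMatrix_isSymm_of_isCellular hL' hA hL simples cover
  · have := h.algClosed
    exact algCartanMatrix_isSymm_of_isDuality hL' hδ fix hL simples cover
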